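/- **Theorem 4.2 (representation formula for $\widehat W$, $D=3$, scalar/anti-plane shear setting).** Let $\Omega'\subset\mathbb R^2$ be a nonempty bounded open set, let $\alpha_1,\alpha_2\in\mathbb R^{2\times2}$ be symmetric positive definite, $f_1^T,f_2^T\in\mathbb R^2$, $w_1,w_2\in\mathbb R$, and $$W_i(v)=\tfrac12\,\alpha_i(v-f_i^T)\cdot(v-f_i^T)+w_i,\qquad v\in\mathbb R^2,\ i=1,2.$$ For $d\in[0,1]$ put $d_1=d$, $d_2=1-d$, and for $f\in\mathbb R^2$ define $$\widehat W(d,f)=\inf_{\tilde d}\ \inf_{\tilde\eta}\ \frac1{|\Omega'|}\int_{\Omega'}\tilde d\,W_1(\nabla\tilde\eta)+(1-\tilde d)\,W_2(\nabla\tilde\eta)\,dx ,$$ where $\tilde d$ runs over $BV(\Omega';\{0,1\})$ with $\frac1{|\Omega'|}\int_{\Omega'}\tilde d\,dx=d$, and $\tilde\eta$ over the functions in $H^1(\Omega')$ with $\tilde\eta=f\cdot x$ on $\partial\Omega'$, i.e. $\tilde\eta-f\cdot x\in H^1_0(\Omega')$. Set $$\nabla\eta_1^*=(d_2\alpha_1+d_1\alpha_2)^{-1}\big[\alpha_2f-d_2(\alpha_2f_2^T-\alpha_1f_1^T)\big],\qquad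 \nabla\eta_2^*=(d_2\alpha_1+d_1\alpha_2)^{-1}\big[\alpha_1f+d_1(\alpha_2f_2^T-\alpha_1f_1^T)\big].$$ Then for all $d\in[0,1]$ and $f\in\mathbb R^2$: 1. (Representation formula) $\displaystyle \widehat W(d,f)=d_1W_1(\nabla\eta_1^*)+d_2W_2(\nabla\eta_2^*).$ Moreover $d_1\nabla\eta_1^*+d_2\nabla\eta_2^*=f$ and $\alpha_1(\nabla\eta_1^*-f_1^T)=\alpha_2(\nabla\eta_2^*-f_2^T)$. 2. (Trivial translation) Let $\phi(v)=v_1^2+v_2^2$. Among all $\beta\ge0$ for which $W_1-\beta\phi$ and $W_2-\beta\phi$ are convex, the translation bound $$\inf_{\substack{v_1,v_2\in\mathbb R^2\\ d_1v_1+d_2v_2=f}}\big\{d_1W_1(v_1)+d_2W_2(v_2)-\beta d_1d_2\,\phi(v_2-v_1)\big\}\in[-\infty,\infty)$$ is maximal at $\beta^*=0$, and its value at $\beta^*=0$ equals $\widehat W(d,f)$. 3. (Optimality of a rank-one laminate) There is a unit vector $n$ such that $\nabla\eta_2^*-\nabla\eta_1^*$ is a multiple of $n$; if $\nabla\eta_1^*\ne\nabla\eta_2^*$,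 it is unique up to sign. For each such $n$ there are $\theta_k\to d$ and functions $\eta_k\in H^1(\Omega')$ with $\eta_k=f\cdot x$ on $\partial\Omega'$ (in the sense above) such that, with $\tilde d_k$ the indicator function of $\{x:\ (k+1)\,n\cdot x-\lfloor (k+1)\,n\cdot x\rfloor<\theta_k\}$ ($k=0,1,2,\dots$), one has $\tilde d_k\in BV(\Omega';\{0,1\})$ with mean exactly $d$ on $\Omega'$; the gradient $\nabla\eta_k$ equals $\nabla\eta_1^*$ where $\tilde d_k=1$ and $\nabla\eta_2^*$ where $\tilde d_k=0$, outside a subset of $\Omega'$ whose measure tends to $0$ as $k\to\infty$; and the averaged energies of $(\tilde d_k,\eta_k)$ converge to $\widehat W(d,f)$. -/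

import Mathlib

open Filter Topology MeasureTheory
open scoped ENNReal ContDiff

noncomputable section

namespace AntiPlane

/-- The plane `ℝ²` with its Euclidean structure. -/
abbrev Plane : Type := EuclideanSpace ℝ (Fin 2)

/-- The action `v ↦ α v` of a real `2 × 2` matrix on the plane. -/
abbrev act (α : Matrix (Fin 2) (Fin 2) ℝ) (v : Plane) : Plane := Matrix.toEuclideanLin α v

/-- Elastic energy density of one phase, `½ α (v - fT) · (v - fT) + w`, with elastic modulus `α`,
transformation strain `fT` and constant `w`. -/
def phaseEnergy (α : Matrix (Fin 2) (Fin 2) ℝ) (fT : Plane) (w : ℝ) (v : Plane) : ℝ :=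
  (1 / 2) * inner ℝ (act α (v - fT)) (v - fT) + w

/-! ### Function spaces on an open subset of the plane -/

/-- `φ ∈ C_c^∞(Ω)`. -/
structure IsTestFunction (Ω : Set Plane) (φ : Plane → ℝ) : Prop where
  smooth : ContDiff ℝ ∞ φ
  compact : HasCompactSupport φ
  support : tsupport φ ⊆ Ω

/-- The divergence `∑ᵢ ∂ᵢ Φᵢ` of a vector field. -/
def divergence (Φ : Plane → Plane) (x : Plane) : ℝ :=
  ∑ i : Fin 2, (fderiv ℝ Φ x (EuclideanSpace.single i 1)) i

/-- `g ∈ BV(Ω)`: `g ∈ L¹(Ω)` and its total variation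
`sup { ∫_Ω g div Φ : Φ ∈ C_c¹(Ω; ℝ²), |Φ| ≤ 1 }` is finite. -/
structure MemBV (Ω : Set Plane) (g : Plane → ℝ) : Prop where
  integrable : IntegrableOn g Ω volume
  variation : ∃ C : ℝ, ∀ Φ : Plane → Plane, ContDiff ℝ 1 Φ → HasCompactSupport Φ →
    tsupport Φ ⊆ Ω → (∀ x, ‖Φ x‖ ≤ 1) → ∫ x in Ω, g x * divergence Φ x ≤ C

/-- `η ∈ H¹(Ω)` with weak gradient `G`. -/
structure HasH1Gradient (Ω : Set Plane) (η : Plane → ℝ) (G : Plane → Plane) : Prop where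
  memLp : MemLp η 2 (volume.restrict Ω)
  memLp_grad : MemLp G 2 (volume.restrict Ω)
  weak : ∀ φ : Plane → ℝ, IsTestFunction Ω φ →
    ∫ x in Ω, η x • gradient φ x = - ∫ x in Ω, φ x • G x

/-- The function `v ∈ H¹(Ω)`, with weak gradient `G`, vanishes on `∂Ω`, that is `v ∈ H¹₀(Ω)`:
it is the limit in `H¹(Ω)` of functions in `C_c^∞(Ω)`. -/
def VanishesOnBoundary (Ω : Set Plane) (v : Plane → ℝ) (G : Plane → Plane) : Prop :=
  ∃ φ : ℕ → Plane → ℝ, (∀ k, IsTestFunction Ω (φ k)) ∧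
    Tendsto (fun k => eLpNorm (fun x => v x - φ k x) 2 (volume.restrict Ω)) atTop (𝓝 0) ∧
    Tendsto (fun k => eLpNorm (fun x => G x - gradient (φ k) x) 2 (volume.restrict Ω)) atTop (𝓝 0)

/-! ### The relaxed energy -/

/-- `χ ∈ BV(Ω; {0,1})` with average `d`: the indicator of the first phase. -/
structure IsPhase (Ω : Set Plane) (d : ℝ) (χ : Plane → ℝ) : Prop where
  memBV : MemBV Ω χ
  zero_or_one : ∀ᵐ x ∂(volume.restrict Ω), χ x = 0 ∨ χ x = 1
  average : ⨍ x in Ω, χ x = d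

/-- `η ∈ H¹(Ω)` with weak gradient `G` and `η = f · x` on `∂Ω`. -/
structure IsAdmissible (Ω : Set Plane) (f : Plane) (η : Plane → ℝ) (G : Plane → Plane) :
    Prop where
  h1 : HasH1Gradient Ω η G
  boundary : VanishesOnBoundary Ω (fun x => η x - inner ℝ f x) (fun x => G x - f)

/-- The averaged energy of the phase arrangement `χ` and the displacement gradient `G`. -/
def averageEnergy (Ω : Set Plane) (W₁ W₂ : Plane → ℝ) (χ : Plane → ℝ) (G : Plane → Plane) : ℝ :=
  ⨍ x in Ω, (χ x * W₁ (G x) + (1 - χ x) * W₂ (G x))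

/-- The relaxed energy `Ŵ(d, f)`; the infima are taken in the extended reals, so that they
have no default value. -/
def relaxedEnergy (Ω : Set Plane) (W₁ W₂ : Plane → ℝ) (d : ℝ) (f : Plane) : EReal :=
  ⨅ (χ : Plane → ℝ) (_ : IsPhase Ω d χ),
    ⨅ (η : Plane → ℝ) (G : Plane → Plane) (_ : IsAdmissible Ω f η G),
      ((averageEnergy Ω W₁ W₂ χ G : ℝ) : EReal)

/-! ### Optimal strains -/

/-- `∇η₁* = (d₂ α₁ + d₁ α₂)⁻¹ [α₂ f - d₂ (α₂ f₂ - α₁ f₁)]` with `d₁ = d`, `d₂ = 1 - d`. -/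
def optimalStrain₁ (α₁ α₂ : Matrix (Fin 2) (Fin 2) ℝ) (f₁ f₂ : Plane) (d : ℝ) (f : Plane) :
    Plane :=
  act ((1 - d) • α₁ + d • α₂)⁻¹ (act α₂ f - (1 - d) • (act α₂ f₂ - act α₁ f₁))

/-- `∇η₂* = (d₂ α₁ + d₁ α₂)⁻¹ [α₁ f + d₁ (α₂ f₂ - α₁ f₁)]` with `d₁ = d`, `d₂ = 1 - d`. -/
def optimalStrain₂ (α₁ α₂ : Matrix (Fin 2) (Fin 2) ℝ) (f₁ f₂ : Plane) (d : ℝ) (f : Plane) :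
    Plane :=
  act ((1 - d) • α₁ + d • α₂)⁻¹ (act α₁ f + d • (act α₂ f₂ - act α₁ f₁))

/-! ### Translation bound -/

/-- The translation function `φ(v) = v₁² + v₂²`. -/
def translation (v : Plane) : ℝ := v 0 ^ 2 + v 1 ^ 2

/-- The parameters `β ≥ 0` for which `W₁ - β φ` and `W₂ - β φ` are convex. -/
def translationParameters (W₁ W₂ : Plane → ℝ) : Set ℝ :=
  {β | 0 ≤ β ∧ ConvexOn ℝ Set.univ (fun v => W₁ v - β * translation v) ∧
    ConvexOn ℝ Set.univ (fun v => W₂ v - β * translation v)}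

/-- The infimum, over `v₁, v₂` with `d₁ v₁ + d₂ v₂ = f`, of
`d₁ W₁(v₁) + d₂ W₂(v₂) - β d₁ d₂ φ(v₂ - v₁)`. -/
def translationBound (W₁ W₂ : Plane → ℝ) (d : ℝ) (f : Plane) (β : ℝ) : EReal :=
  ⨅ (v₁ : Plane) (v₂ : Plane) (_ : d • v₁ + (1 - d) • v₂ = f),
    ((d * W₁ v₁ + (1 - d) * W₂ v₂ - β * d * (1 - d) * translation (v₂ - v₁) : ℝ) : EReal)

/-! ### Rank-one laminates -/

/-- `n` is a unit normal of an interface across which the gradients `a₁` and `a₂` are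
compatible: `a₂ - a₁` is a multiple of `n`. -/
def IsLaminationNormal (a₁ a₂ n : Plane) : Prop :=
  ‖n‖ = 1 ∧ ∃ c : ℝ, a₂ - a₁ = c • n

/-- Indicator of the first phase in a simple laminate with layers normal to `n`, of period
`1 / N`, the first phase filling the fraction `θ` of each period. -/
def laminate (n : Plane) (N θ : ℝ) (x : Plane) : ℝ :=
  if Int.fract (N * inner ℝ n x) < θ then 1 else 0

/-- The pairs of `laminate n (k + 1) (θ k)` and the displacement `η k` with gradient `G k`,
`k → ∞`, are admissible for the volume fraction `d` and the boundary data `f · x`. They form a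
rank-one laminate with normal `n` and strains `a₁`, `a₂` in the two phases: the layers become
infinitely fine, and the gradient equals `a₁` in the first and `a₂` in the second phase, outside
a set of vanishing measure. -/
structure IsRankOneLaminate (Ω : Set Plane) (d : ℝ) (f n a₁ a₂ : Plane)
    (θ : ℕ → ℝ) (η : ℕ → Plane → ℝ) (G : ℕ → Plane → Plane) : Prop where
  normal : IsLaminationNormal a₁ a₂ n
  fraction : Tendsto θ atTop (𝓝 d)
  phase : ∀ k : ℕ, IsPhase Ω d (laminate n (k + 1) (θ k))
  admissible : ∀ k : ℕ, IsAdmissible Ω f (η k) (G k)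
  strain : Tendsto (fun k : ℕ => volume {x ∈ Ω |
    G k x ≠ if laminate n (k + 1) (θ k) x = 1 then a₁ else a₂}) atTop (𝓝 0)

end AntiPlane

end

noncomputable section

namespace AntiPlane

/-! ### The quadratic energy densities -/

/-! Lower bound. Each density is a convex quadratic, so it lies above its tangent plane at every
point (`phaseEnergy_tangent`). The optimal strains are exactly the pair with mean `f` at which the
two tangent planes have the same slope `σ`, the common stress (`optimalStrain_average`,
`optimalStrain_stress`). For any competitor the energy is therefore at least the integral of a
function of the phase alone plus `σ · G`. The volume constraint fixes the first integral and the
boundary condition fixes the mean of `G` at `f` (`IsAdmissible.setIntegral_eq`), so the bound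
depends on no other feature of the competitor (`le_averageEnergy`). The same tangent planes compute
the translation bound at `β = 0`. A positive `β` only subtracts a nonnegative term, because `φ ≥ 0`.

Upper bound. For a scalar displacement any two gradients are compatible across a suitable interface,
so the two strains can be laminated. A sawtooth of amplitude `O(1/N)` realises them exactly in
layers of period `1/N`. Two corrections are needed. The fraction `θ` in each period is tuned by the
intermediate value theorem to give mean exactly `d` (`exists_laminate_average`). Integration by
parts against cutoffs shows `θ → d` (`tendsto_fraction`), so the compensating affine term is small.
The displacement is then truncated by the distance to `∂Ω`, which changes it only in a collar of
vanishing measure and keeps the gradient bounded (`exists_truncation`). The energies converge by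
`tendsto_averageEnergy`.

Membership in the function spaces rests on two facts: compactly supported Lipschitz functions lie in
`H¹₀` by mollification (`vanishesOnBoundary_of_lipschitz`), and a laminate is a difference of two
staircases, each monotone along every line (`memBV_laminate`). -/

lemma inner_eq (u v : Plane) : inner ℝ u v = u 0 * v 0 + u 1 * v 1 := by
  simp [PiLp.inner_apply, Fin.sum_univ_two, mul_comm]

lemma act_apply (α : Matrix (Fin 2) (Fin 2) ℝ) (v : Plane) (i : Fin 2) :
    act α v i = α i 0 * v 0 + α i 1 * v 1 := by
  fin_cases i <;> simp [act, Matrix.toLpLin_apply]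

lemma act_add (α : Matrix (Fin 2) (Fin 2) ℝ) (u v : Plane) :
    act α (u + v) = act α u + act α v := map_add (Matrix.toEuclideanLin α) u v

lemma act_sub (α : Matrix (Fin 2) (Fin 2) ℝ) (u v : Plane) :
    act α (u - v) = act α u - act α v := map_sub (Matrix.toEuclideanLin α) u v

lemma act_smul (α : Matrix (Fin 2) (Fin 2) ℝ) (c : ℝ) (v : Plane) :
    act α (c • v) = c • act α v := map_smul (Matrix.toEuclideanLin α) c v

lemma act_add_smul (a b : ℝ) (α β : Matrix (Fin 2) (Fin 2) ℝ) (v : Plane) :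
    act (a • α + b • β) v = a • act α v + b • act β v := by
  ext i; simp only [act_apply, Matrix.add_apply, Matrix.smul_apply, PiLp.add_apply,
    PiLp.smul_apply, smul_eq_mul]; ring

lemma act_nonsing_inv {M : Matrix (Fin 2) (Fin 2) ℝ} (hM : IsUnit M) (v : Plane) :
    act M (act M⁻¹ v) = v := by
  have h : M * M⁻¹ = 1 := Matrix.mul_nonsing_inv M ((Matrix.isUnit_iff_isUnit_det M).1 hM)
  ext i
  have := congrFun (congrArg (fun A : Matrix (Fin 2) (Fin 2) ℝ => A.mulVec v.ofLp) h) i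
  simpa [act, Matrix.toLpLin_apply, ← Matrix.mulVec_mulVec] using this

lemma act_injective {M : Matrix (Fin 2) (Fin 2) ℝ} (hM : IsUnit M) :
    Function.Injective (act M) := by
  have h : M⁻¹ * M = 1 := Matrix.nonsing_inv_mul M ((Matrix.isUnit_iff_isUnit_det M).1 hM)
  refine Function.LeftInverse.injective (g := act M⁻¹) fun v => ?_
  ext i
  have := congrFun (congrArg (fun A : Matrix (Fin 2) (Fin 2) ℝ => A.mulVec v.ofLp) h) i
  simpa [act, Matrix.toLpLin_apply, ← Matrix.mulVec_mulVec] using this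

lemma inner_act_nonneg {α : Matrix (Fin 2) (Fin 2) ℝ} (hα : α.PosDef) (v : Plane) :
    0 ≤ inner ℝ (act α v) v := by
  have h := hα.posSemidef.dotProduct_mulVec_nonneg v.ofLp
  rw [inner_eq, act_apply, act_apply]
  simp only [dotProduct, Matrix.mulVec, Fin.sum_univ_two, Pi.star_apply, star_trivial] at h
  linarith

/-- The exact second-order expansion of the energy density. -/
lemma phaseEnergy_expand {α : Matrix (Fin 2) (Fin 2) ℝ} (hα : α.PosDef) (fT : Plane) (w : ℝ)
    (a v : Plane) :
    phaseEnergy α fT w v = phaseEnergy α fT w a + inner ℝ (act α (a - fT)) (v - a) +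
      (1 / 2) * inner ℝ (act α (v - a)) (v - a) := by
  have h : α 1 0 = α 0 1 := by simpa using hα.isHermitian.apply 0 1
  simp only [phaseEnergy, inner_eq, act_apply, h, PiLp.sub_apply]; ring

lemma phaseEnergy_tangent {α : Matrix (Fin 2) (Fin 2) ℝ} (hα : α.PosDef) (fT : Plane) (w : ℝ)
    (a v : Plane) :
    phaseEnergy α fT w a + inner ℝ (act α (a - fT)) (v - a) ≤ phaseEnergy α fT w v := by
  rw [phaseEnergy_expand hα fT w a v]
  linarith [inner_act_nonneg hα (v - a)]

/-- The tangent inequalities at the convex combination, weighted by `a` and `b`, add up to convexity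
because their linear terms cancel. -/
lemma convexOn_phaseEnergy {α : Matrix (Fin 2) (Fin 2) ℝ} (hα : α.PosDef) (fT : Plane) (w : ℝ) :
    ConvexOn ℝ Set.univ (phaseEnergy α fT w) := by
  refine ⟨convex_univ, fun x _ y _ a b ha hb hab => ?_⟩
  have hx := mul_le_mul_of_nonneg_left (phaseEnergy_tangent hα fT w (a • x + b • y) x) ha
  have hy := mul_le_mul_of_nonneg_left (phaseEnergy_tangent hα fT w (a • x + b • y) y) hb
  obtain rfl : b = 1 - a := by linarith
  set z := a • x + (1 - a) • y with hz
  have h : a * inner ℝ (act α (z - fT)) (x - z) + (1 - a) * inner ℝ (act α (z - fT)) (y - z) = 0 := by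
    rw [← real_inner_smul_right, ← real_inner_smul_right, ← inner_add_right]
    have : a • (x - z) + (1 - a) • (y - z) = 0 := by rw [hz]; module
    rw [this, inner_zero_right]
  simp only [smul_eq_mul]
  linarith

lemma continuous_phaseEnergy (α : Matrix (Fin 2) (Fin 2) ℝ) (fT : Plane) (w : ℝ) :
    Continuous (phaseEnergy α fT w) := by
  unfold phaseEnergy
  have : Continuous (act α) := (Matrix.toEuclideanLin α).continuous_of_finiteDimensional
  fun_prop

/-- The energy density has quadratic growth. -/
lemma exists_abs_phaseEnergy_le (α : Matrix (Fin 2) (Fin 2) ℝ) (fT : Plane) (w : ℝ) :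
    ∃ C : ℝ, ∀ v, |phaseEnergy α fT w v| ≤ C * (‖v‖ ^ 2 + 1) := by
  set A := LinearMap.toContinuousLinearMap (Matrix.toEuclideanLin α : Plane →ₗ[ℝ] Plane) with hA
  refine ⟨‖A‖ * (1 + ‖fT‖ ^ 2) + |w|, fun v => ?_⟩
  have h1 : |inner ℝ (act α (v - fT)) (v - fT)| ≤ ‖A‖ * ‖v - fT‖ ^ 2 := by
    refine (abs_real_inner_le_norm _ _).trans ?_
    have : ‖act α (v - fT)‖ ≤ ‖A‖ * ‖v - fT‖ := A.le_opNorm _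
    nlinarith [norm_nonneg (v - fT)]
  have h2 : ‖v - fT‖ ^ 2 ≤ 2 * (‖v‖ ^ 2 + ‖fT‖ ^ 2) := by
    have := norm_sub_le v fT
    nlinarith [sq_nonneg (‖v‖ - ‖fT‖), norm_nonneg (v - fT), norm_nonneg v, norm_nonneg fT]
  have h3 : |phaseEnergy α fT w v| ≤ (1 / 2) * |inner ℝ (act α (v - fT)) (v - fT)| + |w| := by
    unfold phaseEnergy
    refine (abs_add_le _ _).trans ?_
    rw [abs_mul, abs_of_pos (by norm_num : (0 : ℝ) < 1 / 2)]
  have h4 : ‖A‖ * ‖v - fT‖ ^ 2 ≤ ‖A‖ * (2 * (‖v‖ ^ 2 + ‖fT‖ ^ 2)) := by gcongr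
  have h5 : 0 ≤ ‖A‖ * (‖fT‖ ^ 2 * ‖v‖ ^ 2 + 1) := by positivity
  have h6 : 0 ≤ |w| * ‖v‖ ^ 2 := by positivity
  nlinarith

/-! ### The optimal strains -/

section OptimalStrain

variable {α₁ α₂ : Matrix (Fin 2) (Fin 2) ℝ} {d : ℝ}

lemma posDef_mixture (hα₁ : α₁.PosDef) (hα₂ : α₂.PosDef) (hd : d ∈ Set.Icc (0 : ℝ) 1) :
    ((1 - d) • α₁ + d • α₂).PosDef := by
  obtain ⟨h0, h1⟩ := hd
  -- At the endpoints one summand vanishes, and a zero multiple is not positive definite, so these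
  -- cases are separate.
  rcases h0.eq_or_lt with rfl | h0
  · simpa using hα₁
  · rcases h1.eq_or_lt with rfl | h1
    · simpa using hα₂
    · exact (hα₁.smul (by linarith : (0 : ℝ) < 1 - d)).add (hα₂.smul h0)

variable (hα₁ : α₁.PosDef) (hα₂ : α₂.PosDef) (hd : d ∈ Set.Icc (0 : ℝ) 1) (f₁ f₂ f : Plane)
include hα₁ hα₂ hd

/-- After applying the invertible mixture matrix, the terms in `α₂ f₂ - α₁ f₁` cancel and the
mixture acting on `f` remains. -/
lemma optimalStrain_average :
    d • optimalStrain₁ α₁ α₂ f₁ f₂ d f + (1 - d) • optimalStrain₂ α₁ α₂ f₁ f₂ d f = f := by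
  have hM := (posDef_mixture hα₁ hα₂ hd).isUnit
  refine act_injective hM ?_
  rw [act_add, act_smul, act_smul, optimalStrain₁, optimalStrain₂, act_nonsing_inv hM,
    act_nonsing_inv hM, act_add_smul]
  module

/-- The mixture matrix applied to `a₂ - a₁` is `(α₁ - α₂) f + (α₂ f₂ - α₁ f₁)`. Replacing `f` by the
mean of the strains turns this identity into equality of the stresses. -/
lemma optimalStrain_stress :
    act α₁ (optimalStrain₁ α₁ α₂ f₁ f₂ d f - f₁) =
      act α₂ (optimalStrain₂ α₁ α₂ f₁ f₂ d f - f₂) := by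
  have hM := (posDef_mixture hα₁ hα₂ hd).isUnit
  have hf := optimalStrain_average hα₁ hα₂ hd f₁ f₂ f
  set a₁ := optimalStrain₁ α₁ α₂ f₁ f₂ d f with h₁
  set a₂ := optimalStrain₂ α₁ α₂ f₁ f₂ d f with h₂
  have e : act ((1 - d) • α₁ + d • α₂) (a₂ - a₁) =
      (act α₁ f - act α₂ f) + (act α₂ f₂ - act α₁ f₁) := by
    rw [act_sub, h₁, h₂, optimalStrain₁, optimalStrain₂, act_nonsing_inv hM, act_nonsing_inv hM]
    module
  rw [act_add_smul, act_sub, act_sub] at e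
  have e₁ : act α₁ f = d • act α₁ a₁ + (1 - d) • act α₁ a₂ := by
    rw [← act_smul, ← act_smul, ← act_add, hf]
  have e₂ : act α₂ f = d • act α₂ a₁ + (1 - d) • act α₂ a₂ := by
    rw [← act_smul, ← act_smul, ← act_add, hf]
  rw [e₁, e₂] at e
  rw [act_sub, act_sub, ← sub_eq_zero]
  rw [← sub_eq_zero] at e
  rw [← neg_eq_zero, ← e]
  module

end OptimalStrain

/-! ### The lower bound -/

lemma norm_gradient (φ : Plane → ℝ) (x : Plane) : ‖gradient φ x‖ = ‖fderiv ℝ φ x‖ := by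
  simp [gradient]

lemma tsupport_gradient_subset (φ : Plane → ℝ) : tsupport (gradient φ) ⊆ tsupport φ := by
  refine closure_minimal (fun x hx => ?_) (isClosed_tsupport φ)
  refine tsupport_fderiv_subset ℝ (subset_closure ?_)
  rw [Function.mem_support] at hx ⊢
  rwa [← norm_ne_zero_iff, ← norm_gradient, norm_ne_zero_iff]

lemma continuous_gradient {φ : Plane → ℝ} (h : ContDiff ℝ 1 φ) : Continuous (gradient φ) := by
  unfold gradient
  exact (LinearIsometryEquiv.continuous _).comp (h.continuous_fderiv (by norm_num))

lemma HasCompactSupport.gradient {φ : Plane → ℝ} (h : HasCompactSupport φ) :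
    HasCompactSupport (gradient φ) :=
  h.of_isClosed_subset (isClosed_tsupport _) (tsupport_gradient_subset φ)

/-- Integration by parts against the constant function `1`. -/
lemma integral_fderiv_apply_eq_zero {φ : Plane → ℝ} (h : ContDiff ℝ 1 φ) (hc : HasCompactSupport φ)
    (v : Plane) : ∫ x, fderiv ℝ φ x v = 0 := by
  have h1 : Integrable (fun x => fderiv ℝ φ x v) :=
    ((h.continuous_fderiv (by norm_num)).clm_apply continuous_const).integrable_of_hasCompactSupport
      (hc.fderiv_apply ℝ v)
  have := integral_mul_fderiv_eq_neg_fderiv_mul_of_integrable (𝕜 := ℝ) (μ := volume)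
    (f := fun _ : Plane => (1 : ℝ)) (g := φ) (v := v) (by simp) (by simpa using h1)
    (by simpa using h.continuous.integrable_of_hasCompactSupport hc) (by fun_prop)
    (fun x _ => h.differentiable (by norm_num) x)
  simpa using this

lemma setIntegral_gradient_eq_zero {Ω : Set Plane} {φ : Plane → ℝ} (h : IsTestFunction Ω φ) :
    ∫ x in Ω, gradient φ x = 0 := by
  have h1 : ContDiff ℝ 1 φ := h.smooth.of_le (by exact_mod_cast le_top)
  have hi : Integrable (gradient φ) := (continuous_gradient h1).integrable_of_hasCompactSupport
    (HasCompactSupport.gradient h.compact)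
  rw [setIntegral_eq_integral_of_forall_compl_eq_zero]
  · refine ext_inner_right ℝ fun v => ?_
    rw [real_inner_comm, ← integral_inner hi]
    simpa using integral_fderiv_apply_eq_zero h1 h.compact v
  · intro x hx
    exact image_eq_zero_of_notMem_tsupport
      (fun h' => hx (h.support (tsupport_gradient_subset φ h')))

/-- The field `G - f` is an `L²` limit of gradients of test functions, each with zero integral. On a
set of finite measure Hölder's inequality makes this an `L¹` limit, so its integral vanishes too. -/
lemma IsAdmissible.setIntegral_eq {Ω : Set Plane} (hΩ : volume Ω ≠ ⊤) {f : Plane} {η : Plane → ℝ}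
    {G : Plane → Plane} (h : IsAdmissible Ω f η G) :
    ∫ x in Ω, G x = volume.real Ω • f := by
  have : IsFiniteMeasure (volume.restrict Ω) := ⟨by simpa using hΩ.lt_top⟩
  have hG : Integrable G (volume.restrict Ω) := h.h1.memLp_grad.integrable (by norm_num)
  obtain ⟨φ, hφ, -, hlim⟩ := h.boundary
  have hφi (k : ℕ) : Integrable (gradient (φ k)) (volume.restrict Ω) :=
    ((continuous_gradient ((hφ k).smooth.of_le
      (by exact_mod_cast le_top))).integrable_of_hasCompactSupport
      (HasCompactSupport.gradient (hφ k).compact)).restrict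
  have hm : AEStronglyMeasurable (fun x => G x - f) (volume.restrict Ω) :=
    (hG.sub (integrable_const f)).aestronglyMeasurable
  have hL1 : Tendsto (fun k => eLpNorm (gradient (φ k) - fun x => G x - f) 1
      (volume.restrict Ω)) atTop (𝓝 0) := by
    have hb := ENNReal.Tendsto.mul_const hlim
      (b := volume.restrict Ω Set.univ ^ (1 / (1 : ℝ≥0∞).toReal - 1 / (2 : ℝ≥0∞).toReal))
      (Or.inr (ENNReal.rpow_ne_top_of_nonneg (by norm_num) (measure_ne_top _ _)))
    rw [zero_mul] at hb
    refine tendsto_of_tendsto_of_tendsto_of_le_of_le tendsto_const_nhds hb (fun _ => zero_le)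
      fun k => ?_
    simp only
    rw [eLpNorm_sub_comm]
    exact eLpNorm_le_eLpNorm_mul_rpow_measure_univ (by norm_num)
      (hm.sub (hφi k).aestronglyMeasurable)
  have hint := tendsto_integral_of_L1' _ hm (Eventually.of_forall hφi) hL1
  simp only [setIntegral_gradient_eq_zero (hφ _)] at hint
  have h0 := tendsto_nhds_unique hint tendsto_const_nhds
  rw [integral_sub hG (integrable_const f), integral_const, sub_eq_zero] at h0
  simpa using h0

lemma integrable_phaseEnergy_comp {Ω : Set Plane} (hΩ : volume Ω ≠ ⊤) {G : Plane → Plane}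
    (hG : MemLp G 2 (volume.restrict Ω)) (α : Matrix (Fin 2) (Fin 2) ℝ) (fT : Plane) (w : ℝ) :
    IntegrableOn (fun x => phaseEnergy α fT w (G x)) Ω := by
  have : IsFiniteMeasure (volume.restrict Ω) := ⟨by simpa using hΩ.lt_top⟩
  obtain ⟨C, hC⟩ := exists_abs_phaseEnergy_le α fT w
  have h2 : Integrable (fun x => ‖G x‖ ^ 2) (volume.restrict Ω) := by
    simpa using hG.integrable_norm_pow (p := 2) (by norm_num)
  refine Integrable.mono' ((h2.add (integrable_const (1 : ℝ))).const_mul C)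
    ((continuous_phaseEnergy α fT w).comp_aestronglyMeasurable hG.aestronglyMeasurable)
    (Eventually.of_forall fun x => ?_)
  exact hC (G x)

lemma IsPhase.integrable_mul {Ω : Set Plane} {d : ℝ} {χ : Plane → ℝ} (h : IsPhase Ω d χ)
    {g : Plane → ℝ} (hg : IntegrableOn g Ω) : IntegrableOn (fun x => χ x * g x) Ω :=
  Integrable.bdd_mul (c := 1) hg h.memBV.integrable.aestronglyMeasurable
    (h.zero_or_one.mono fun x hx => by rcases hx with hx | hx <;> simp [hx])

lemma IsPhase.setIntegral_eq {Ω : Set Plane} (hΩ : volume Ω ≠ ⊤) (hΩ0 : volume Ω ≠ 0) {d : ℝ}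
    {χ : Plane → ℝ} (h : IsPhase Ω d χ) : ∫ x in Ω, χ x = volume.real Ω * d := by
  have hpos : volume.real Ω ≠ 0 := by simp [Measure.real, ENNReal.toReal_eq_zero_iff, hΩ, hΩ0]
  rw [← h.average, setAverage_eq, smul_eq_mul, mul_inv_cancel_left₀ hpos]

lemma IsPhase.average_mixture {Ω : Set Plane} (hΩ : volume Ω ≠ ⊤) (hΩ0 : volume Ω ≠ 0) {d : ℝ}
    {χ : Plane → ℝ} (h : IsPhase Ω d χ) (t₁ t₂ : ℝ) :
    ∫ x in Ω, (χ x * t₁ + (1 - χ x) * t₂) = volume.real Ω * (d * t₁ + (1 - d) * t₂) := by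
  have : IsFiniteMeasure (volume.restrict Ω) := ⟨by simpa using hΩ.lt_top⟩
  have hχ : Integrable χ (volume.restrict Ω) := h.memBV.integrable
  have e : (fun x => χ x * t₁ + (1 - χ x) * t₂) = fun x => χ x * (t₁ - t₂) + t₂ := by
    ext x; ring
  rw [e, integral_add (hχ.mul_const _) (integrable_const _), integral_mul_const,
    h.setIntegral_eq hΩ hΩ0, integral_const]
  simp only [measureReal_restrict_apply_univ, smul_eq_mul]
  ring

/-- If the two densities have tangent planes of equal slope `σ` at `a₁` and `a₂`, with
`d a₁ + (1 - d) a₂ = f`, then no admissible pair has an energy below the mean of the two values. -/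
lemma le_averageEnergy {Ω : Set Plane} (hΩ : volume Ω ≠ ⊤) (hΩ0 : volume Ω ≠ 0) {d : ℝ}
    {f a₁ a₂ σ : Plane} {W₁ W₂ : Plane → ℝ} {χ : Plane → ℝ} {η : Plane → ℝ} {G : Plane → Plane}
    (hχ : IsPhase Ω d χ) (hη : IsAdmissible Ω f η G) (hf : d • a₁ + (1 - d) • a₂ = f)
    (h₁ : ∀ v, W₁ a₁ + inner ℝ σ (v - a₁) ≤ W₁ v) (h₂ : ∀ v, W₂ a₂ + inner ℝ σ (v - a₂) ≤ W₂ v)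
    (hi₁ : IntegrableOn (fun x => W₁ (G x)) Ω) (hi₂ : IntegrableOn (fun x => W₂ (G x)) Ω) :
    d * W₁ a₁ + (1 - d) * W₂ a₂ ≤ averageEnergy Ω W₁ W₂ χ G := by
  have : IsFiniteMeasure (volume.restrict Ω) := ⟨by simpa using hΩ.lt_top⟩
  have hpos : 0 < volume.real Ω := ENNReal.toReal_pos hΩ0 hΩ
  -- `t₁` and `t₂` are the heights over the origin of the two parallel tangent planes.
  set t₁ := W₁ a₁ - inner ℝ σ a₁
  set t₂ := W₂ a₂ - inner ℝ σ a₂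
  have hG : Integrable G (volume.restrict Ω) := hη.h1.memLp_grad.integrable (by norm_num)
  have hχi : Integrable χ (volume.restrict Ω) := hχ.memBV.integrable
  have hmix : Integrable (fun x => χ x * t₁ + (1 - χ x) * t₂) (volume.restrict Ω) :=
    (hχi.mul_const t₁).add (((integrable_const 1).sub hχi).mul_const t₂)
  have hlow : ∫ x in Ω, ((χ x * t₁ + (1 - χ x) * t₂) + inner ℝ σ (G x)) ≤
      ∫ x in Ω, (χ x * W₁ (G x) + (1 - χ x) * W₂ (G x)) := by
    refine integral_mono_ae (hmix.add (hG.const_inner σ)) ?_ ?_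
    · have e : (fun x => χ x * W₁ (G x) + (1 - χ x) * W₂ (G x)) =
          fun x => χ x * W₁ (G x) + (W₂ (G x) - χ x * W₂ (G x)) := by ext x; ring
      rw [e]
      exact (hχ.integrable_mul hi₁).add (Integrable.sub hi₂ (hχ.integrable_mul hi₂))
    · filter_upwards [hχ.zero_or_one] with x hx
      have e₁ := h₁ (G x)
      have e₂ := h₂ (G x)
      rw [inner_sub_right] at e₁ e₂
      rcases hx with hx | hx <;> simp only [hx, t₁, t₂] <;> linarith
  rw [integral_add hmix (hG.const_inner σ), hχ.average_mixture hΩ hΩ0, integral_inner hG,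
    hη.setIntegral_eq hΩ, real_inner_smul_right, ← hf, inner_add_right, real_inner_smul_right,
    real_inner_smul_right] at hlow
  rw [averageEnergy, setAverage_eq, smul_eq_mul, le_inv_mul_iff₀ hpos]
  refine le_trans (le_of_eq ?_) hlow
  simp only [t₁, t₂]; ring

/-! ### The translation bound -/

/-- The pair `(a₁, a₂)` attains the infimum: in the weighted sum of tangent inequalities the linear
terms cancel, since both pairs have mean `f`. -/
lemma translationBound_zero {d : ℝ} (hd : d ∈ Set.Icc (0 : ℝ) 1)
    {f a₁ a₂ σ : Plane} {W₁ W₂ : Plane → ℝ} (hf : d • a₁ + (1 - d) • a₂ = f)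
    (h₁ : ∀ v, W₁ a₁ + inner ℝ σ (v - a₁) ≤ W₁ v) (h₂ : ∀ v, W₂ a₂ + inner ℝ σ (v - a₂) ≤ W₂ v) :
    translationBound W₁ W₂ d f 0 = ((d * W₁ a₁ + (1 - d) * W₂ a₂ : ℝ) : EReal) := by
  refine le_antisymm ?_ ?_
  · unfold translationBound
    refine iInf_le_of_le a₁ (iInf_le_of_le a₂ (iInf_le_of_le hf (le_of_eq ?_)))
    simp
  · simp only [translationBound, le_iInf_iff]
    intro v₁ v₂ hv
    rw [EReal.coe_le_coe_iff]
    have e₁ := mul_le_mul_of_nonneg_left (h₁ v₁) hd.1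
    have e₂ := mul_le_mul_of_nonneg_left (h₂ v₂) (sub_nonneg.2 hd.2)
    have e : d * inner ℝ σ (v₁ - a₁) + (1 - d) * inner ℝ σ (v₂ - a₂) = 0 := by
      rw [← real_inner_smul_right, ← real_inner_smul_right, ← inner_add_right]
      have : d • (v₁ - a₁) + (1 - d) • (v₂ - a₂) =
          (d • v₁ + (1 - d) • v₂) - (d • a₁ + (1 - d) • a₂) := by module
      rw [this, hv, hf, sub_self, inner_zero_right]
    linarith

lemma isMaxOn_translationBound {d : ℝ} (hd : d ∈ Set.Icc (0 : ℝ) 1) (f : Plane)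
    (W₁ W₂ : Plane → ℝ) :
    IsMaxOn (translationBound W₁ W₂ d f) (translationParameters W₁ W₂) 0 := by
  intro β hβ
  simp only [Set.mem_ofPred_eq, translationBound]
  refine iInf_mono fun v₁ => iInf_mono fun v₂ => iInf_mono fun _ => ?_
  rw [EReal.coe_le_coe_iff]
  have hβ0 : 0 ≤ β := hβ.1
  have h1 : 0 ≤ 1 - d := sub_nonneg.2 hd.2
  have h0 := hd.1
  have : 0 ≤ translation (v₂ - v₁) := by unfold translation; positivity
  have : 0 ≤ β * d * (1 - d) * translation (v₂ - v₁) := by positivity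
  linarith

/-! ### Lamination normals -/

lemma exists_isLaminationNormal (a₁ a₂ : Plane) : ∃ n, IsLaminationNormal a₁ a₂ n := by
  by_cases h : a₂ - a₁ = 0
  -- For equal strains every unit vector is a normal, with multiple `0`.
  · exact ⟨EuclideanSpace.single 0 1, by simp, 0, by simp [h]⟩
  · have h' : ‖a₂ - a₁‖ ≠ 0 := norm_ne_zero_iff.2 h
    refine ⟨‖a₂ - a₁‖⁻¹ • (a₂ - a₁), by simp [norm_smul, h'], ‖a₂ - a₁‖, ?_⟩
    rw [smul_smul, mul_inv_cancel₀ h', one_smul]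

lemma IsLaminationNormal.eq_or_eq_neg {a₁ a₂ m n : Plane} (h : a₁ ≠ a₂)
    (hm : IsLaminationNormal a₁ a₂ m) (hn : IsLaminationNormal a₁ a₂ n) : m = n ∨ m = -n := by
  obtain ⟨hm, c, hc⟩ := hm
  obtain ⟨hn, e, he⟩ := hn
  have hc0 : c ≠ 0 := by
    rintro rfl
    exact h (sub_eq_zero.1 (by simpa using hc)).symm
  have hce : |c| = |e| := by
    simpa [norm_smul, hm, hn] using congrArg norm (hc.symm.trans he)
  rw [hc] at he
  rcases abs_eq_abs.1 hce with rfl | rfl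
  · exact Or.inl (smul_right_injective _ hc0 he)
  · refine Or.inr (smul_right_injective _ hc0 ?_)
    simp only [he, smul_neg, neg_smul, neg_neg]

/-! ### Lipschitz functions of compact support belong to `H¹₀` -/

section Lipschitz

open scoped NNReal Convolution

lemma norm_gradient_le {v : Plane → ℝ} {K : ℝ≥0} (hv : LipschitzWith K v) (x : Plane) :
    ‖gradient v x‖ ≤ K := by
  rw [norm_gradient]; exact norm_fderiv_le_of_lipschitz ℝ hv

lemma stronglyMeasurable_gradient (v : Plane → ℝ) : StronglyMeasurable (gradient v) := by
  unfold gradient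
  exact ((LinearIsometryEquiv.continuous _).measurable.comp (measurable_fderiv ℝ v)).stronglyMeasurable

lemma LipschitzWith.ae_lineDeriv_eq {v : Plane → ℝ} {K : ℝ≥0} (hv : LipschitzWith K v) (w : Plane) :
    ∀ᵐ x, lineDeriv ℝ v x w = fderiv ℝ v x w := by
  filter_upwards [hv.ae_differentiableAt (μ := volume)] with x hx
  exact hx.lineDeriv_eq_fderiv

/-- By Rademacher's theorem the line derivatives in the Lipschitz integration-by-parts formula agree
almost everywhere with `fderiv`. -/
lemma integral_fderiv_mul_eq {v φ : Plane → ℝ} {K L : ℝ≥0} (hv : LipschitzWith K v)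
    (hφ : LipschitzWith L φ) (hc : HasCompactSupport φ) (w : Plane) :
    ∫ x, fderiv ℝ v x w * φ x = - ∫ x, fderiv ℝ φ x w * v x := by
  have h := LipschitzWith.integral_lineDeriv_mul_eq (μ := volume) hv hφ hc w
  rw [← integral_neg]
  refine Eq.trans (integral_congr_ae ?_) (h.trans (integral_congr_ae ?_))
  · filter_upwards [LipschitzWith.ae_lineDeriv_eq hv w] with x hx
    rw [hx]
  · filter_upwards [LipschitzWith.ae_lineDeriv_eq hφ w] with x hx
    rw [lineDeriv_neg, hx, neg_mul]

lemma exists_lipschitzWith {φ : Plane → ℝ} (h : ContDiff ℝ 1 φ) (hc : HasCompactSupport φ) :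
    ∃ L : ℝ≥0, LipschitzWith L φ :=
  h.lipschitzWith_of_hasCompactSupport hc (by norm_num)

lemma IsTestFunction.contDiff_one {Ω : Set Plane} {φ : Plane → ℝ} (h : IsTestFunction Ω φ) :
    ContDiff ℝ 1 φ := h.smooth.of_le (by exact_mod_cast le_top)

lemma hasH1Gradient_of_lipschitz {Ω : Set Plane} (hΩ : volume Ω ≠ ⊤) {v : Plane → ℝ} {K : ℝ≥0}
    (hv : LipschitzWith K v) (hb : ∃ C, ∀ x ∈ Ω, |v x| ≤ C) (hm : MeasurableSet Ω) :
    HasH1Gradient Ω v (gradient v) := by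
  have : IsFiniteMeasure (volume.restrict Ω) := ⟨by simpa using hΩ.lt_top⟩
  obtain ⟨C, hC⟩ := hb
  refine ⟨?_, ?_, fun φ hφ => ?_⟩
  · exact MemLp.of_bound hv.continuous.aestronglyMeasurable C
      ((ae_restrict_iff' hm).2 (Eventually.of_forall hC))
  · exact MemLp.of_bound (stronglyMeasurable_gradient v).aestronglyMeasurable K
      (Eventually.of_forall (norm_gradient_le hv))
  · obtain ⟨L, hL⟩ := exists_lipschitzWith hφ.contDiff_one hφ.compact
    have hφs (x : Plane) (hx : x ∉ Ω) : φ x = 0 :=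
      image_eq_zero_of_notMem_tsupport fun h => hx (hφ.support h)
    have hgs (x : Plane) (hx : x ∉ Ω) : gradient φ x = 0 :=
      image_eq_zero_of_notMem_tsupport fun h => hx (hφ.support (tsupport_gradient_subset φ h))
    rw [setIntegral_eq_integral_of_forall_compl_eq_zero fun x hx => by simp [hgs x hx],
      setIntegral_eq_integral_of_forall_compl_eq_zero fun x hx => by simp [hφs x hx]]
    have i1 : Integrable (fun x => v x • gradient φ x) :=
      (hv.continuous.smul (continuous_gradient hφ.contDiff_one)).integrable_of_hasCompactSupport
        (HasCompactSupport.gradient hφ.compact).smul_left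
    have i2 : Integrable (fun x => φ x • gradient v x) := by
      have hφi := (hφ.contDiff_one.continuous.integrable_of_hasCompactSupport (μ := volume) hφ.compact)
      exact hφi.smul_bdd (K : ℝ) (stronglyMeasurable_gradient v).aestronglyMeasurable
        (Eventually.of_forall (norm_gradient_le hv))
    -- Pairing with a fixed `w` reduces the vector identity to scalar integration by parts in
    -- direction `w`.
    refine ext_inner_left ℝ fun w => ?_
    rw [inner_neg_right, ← integral_inner i1, ← integral_inner i2]
    have h := integral_fderiv_mul_eq hv hL hφ.compact w
    simp only [real_inner_smul_right, inner_gradient_right, conj_trivial]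
    rw [eq_neg_iff_add_eq_zero, ← eq_neg_iff_add_eq_zero.1 h, add_comm]
    simp only [mul_comm]

/-- A bounded sequence which converges almost everywhere converges in `L²`. -/
lemma tendsto_eLpNorm_two_of_bounded {F : Type*} [NormedAddCommGroup F] {μ : Measure Plane}
    [IsFiniteMeasure μ] {g : ℕ → Plane → F} {h : Plane → F} {C : ℝ}
    (hg : ∀ k, AEStronglyMeasurable (g k) μ) (hh : AEStronglyMeasurable h μ)
    (hgb : ∀ k x, ‖g k x‖ ≤ C) (hhb : ∀ x, ‖h x‖ ≤ C)
    (hlim : ∀ᵐ x ∂μ, Tendsto (fun k => g k x) atTop (𝓝 (h x))) :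
    Tendsto (fun k => eLpNorm (fun x => h x - g k x) 2 μ) atTop (𝓝 0) := by
  have := tendsto_Lp_finite_of_tendsto_ae (p := 2) (by norm_num) (by norm_num) hg
    (MemLp.of_bound hh C (Eventually.of_forall hhb))
    -- The threshold `|C| + 1` exceeds the common bound, so the tails required to be small are
    -- empty.
    (unifIntegrable_of (by norm_num) (by norm_num) hg fun ε hε =>
      ⟨Real.toNNReal (|C| + 1), fun k => ?_⟩) hlim
  · refine this.congr fun k => ?_
    rw [eLpNorm_sub_comm]; rfl
  · have : {x | Real.toNNReal (|C| + 1) ≤ ‖g k x‖₊} = ∅ := by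
      ext x
      simp only [Set.mem_ofPred_eq, Set.mem_empty_iff_false, iff_false, Real.toNNReal_le_iff_le_coe,
        coe_nnnorm]
      linarith [hgb k x, le_abs_self C]
    rw [this]; simp

/-! ### Mollification of Lipschitz functions -/

/-- A mollifier supported in the ball of radius `1 / (k + 1)`. -/
def mollifier (k : ℕ) : ContDiffBump (0 : Plane) where
  rIn := 1 / (2 * ((k : ℝ) + 1))
  rOut := 1 / ((k : ℝ) + 1)
  rIn_pos := by positivity
  rIn_lt_rOut := by
    have : (0 : ℝ) < k + 1 := by positivity
    exact one_div_lt_one_div_of_lt this (by linarith)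

/-- The mollification of `v` at scale `1 / (k + 1)`. -/
def mollify (k : ℕ) (v : Plane → ℝ) : Plane → ℝ :=
  (mollifier k).normed volume ⋆[ContinuousLinearMap.lsmul ℝ ℝ, volume] v

variable {v : Plane → ℝ} {K : ℝ≥0}

lemma integrable_mollifier (k : ℕ) : Integrable ((mollifier k).normed volume) :=
  (mollifier k).integrable_normed

/-- Differentiation under the integral puts the derivative on `v`: the integrand is Lipschitz in `x`
with an integrable constant, and by Rademacher it is differentiable for almost every `t`. The
derivatives of the mollifications thus inherit the bound `K` and converge almost everywhere. -/
lemma hasFDerivAt_mollify (hv : LipschitzWith K v) (k : ℕ) (x : Plane) :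
    HasFDerivAt (mollify k v)
      (((mollifier k).normed volume ⋆[ContinuousLinearMap.lsmul ℝ ℝ, volume] (fderiv ℝ v)) x) x := by
  have hcont : Continuous ((mollifier k).normed volume) := (mollifier k).continuous_normed
  have hb := integrable_mollifier k
  refine (hasFDerivAt_integral_of_dominated_loc_of_lip (𝕜 := ℝ) (μ := volume)
    (F := fun x t => (mollifier k).normed volume t • v (x - t))
    (F' := fun t => (mollifier k).normed volume t • fderiv ℝ v (x - t)) (x₀ := x) (s := Set.univ)
    (bound := fun t => (mollifier k).normed volume t * K) univ_mem ?_ ?_ ?_ ?_ ?_ ?_).2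
  · refine Eventually.of_forall fun y => ?_
    exact (hcont.smul (hv.continuous.comp (by fun_prop))).aestronglyMeasurable
  · refine Continuous.integrable_of_hasCompactSupport
      (hcont.smul (hv.continuous.comp (by fun_prop))) ?_
    exact (mollifier k).hasCompactSupport_normed.smul_right
  · refine hcont.aestronglyMeasurable.smul ?_
    exact ((measurable_fderiv ℝ v).comp (by fun_prop)).aestronglyMeasurable
  · refine Eventually.of_forall fun t => LipschitzWith.lipschitzOnWith ?_
    refine LipschitzWith.of_dist_le_mul fun y z => ?_
    have h1 := hv.dist_le_mul (y - t) (z - t)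
    have h0 : 0 ≤ (mollifier k).normed volume t := (mollifier k).nonneg_normed t
    rw [dist_sub_right] at h1
    rw [dist_smul₀, Real.norm_of_nonneg h0]
    rw [Real.coe_nnabs, abs_of_nonneg (mul_nonneg h0 K.coe_nonneg), mul_assoc]
    exact mul_le_mul_of_nonneg_left h1 h0
  · exact hb.mul_const _
  · have hae := hv.ae_differentiableAt (μ := volume)
    have := (quasiMeasurePreserving_sub_left volume x).ae hae
    filter_upwards [this] with t ht
    have h := ht.hasFDerivAt.comp x ((hasFDerivAt_id x).sub_const t)
    rw [ContinuousLinearMap.comp_id] at h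
    exact h.const_smul ((mollifier k).normed volume t)

lemma locallyIntegrable_fderiv (hv : LipschitzWith K v) : LocallyIntegrable (fderiv ℝ v) volume :=
  (memLp_top_of_bound (measurable_fderiv ℝ v).aestronglyMeasurable K
    (Eventually.of_forall fun _ => norm_fderiv_le_of_lipschitz ℝ hv)).locallyIntegrable le_top

lemma norm_mollify_le {E : Type*} [NormedAddCommGroup E] [NormedSpace ℝ E] {g : Plane → E} {C : ℝ}
    (hg : ∀ x, ‖g x‖ ≤ C) (k : ℕ) (x : Plane) :
    ‖((mollifier k).normed volume ⋆[ContinuousLinearMap.lsmul ℝ ℝ, volume] g) x‖ ≤ C := by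
  have h := norm_integral_le_of_norm_le ((integrable_mollifier k).mul_const C)
    (f := fun t => (mollifier k).normed volume t • g (x - t)) (Eventually.of_forall fun t => ?_)
  · refine h.trans (le_of_eq ?_)
    rw [integral_mul_const, (mollifier k).integral_normed, one_mul]
  · rw [norm_smul, Real.norm_of_nonneg ((mollifier k).nonneg_normed t)]
    exact mul_le_mul_of_nonneg_left (hg _) ((mollifier k).nonneg_normed t)

lemma ae_tendsto_mollify {E : Type*} [NormedAddCommGroup E] [NormedSpace ℝ E] [CompleteSpace E]
    {g : Plane → E} (hg : LocallyIntegrable g volume) :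
    ∀ᵐ x, Tendsto (fun k => ((mollifier k).normed volume
      ⋆[ContinuousLinearMap.lsmul ℝ ℝ, volume] g) x) atTop (𝓝 (g x)) := by
  -- The constant `2` is the ratio of the outer to the inner radius of each mollifier.
  refine ContDiffBump.ae_convolution_tendsto_right_of_locallyIntegrable (K := 2) ?_ ?_ hg
  · exact tendsto_one_div_add_atTop_nhds_zero_nat
  · refine Eventually.of_forall fun k => le_of_eq ?_
    simp only [mollifier]; field_simp

lemma tsupport_mollify_subset (k : ℕ) :
    tsupport (mollify k v) ⊆ Metric.cthickening (1 / ((k : ℝ) + 1)) (tsupport v) := by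
  refine closure_minimal (fun x hx => ?_) Metric.isClosed_cthickening
  obtain ⟨y, hy, z, hz, rfl⟩ := support_convolution_subset _ hx
  rw [(mollifier k).support_normed_eq, mem_ball_zero_iff] at hy
  refine Metric.mem_cthickening_of_dist_le _ z _ _ (subset_tsupport _ hz) ?_
  simpa [dist_eq_norm, mollifier] using hy.le

lemma contDiff_mollify (hv : LipschitzWith K v) (k : ℕ) : ContDiff ℝ ∞ (mollify k v) :=
  HasCompactSupport.contDiff_convolution_left _ (mollifier k).hasCompactSupport_normed
    (mollifier k).contDiff_normed hv.continuous.locallyIntegrable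

lemma vanishesOnBoundary_of_lipschitz {Ω : Set Plane} (hΩ : IsOpen Ω) (hfin : volume Ω ≠ ⊤)
    (hv : LipschitzWith K v) (hc : HasCompactSupport v) (hs : tsupport v ⊆ Ω) :
    VanishesOnBoundary Ω v (gradient v) := by
  have : IsFiniteMeasure (volume.restrict Ω) := ⟨by simpa using hfin.lt_top⟩
  obtain ⟨δ, hδ, hδΩ⟩ := IsCompact.exists_cthickening_subset_open hc hΩ hs
  -- Starting the sequence at `k₀` keeps every support inside `Ω`.
  obtain ⟨k₀, hk₀⟩ := exists_nat_one_div_lt hδ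
  obtain ⟨C, hC⟩ := hv.continuous.bounded_above_of_compact_support hc
  have hsub (k : ℕ) : tsupport (mollify (k + k₀) v) ⊆ Metric.cthickening δ (tsupport v) := by
    refine (tsupport_mollify_subset _).trans (Metric.cthickening_mono (le_trans ?_ hk₀.le) _)
    refine one_div_le_one_div_of_le (by positivity) ?_
    push_cast; linarith [(Nat.cast_nonneg k : (0 : ℝ) ≤ k)]
  refine ⟨fun k => mollify (k + k₀) v, fun k => ⟨contDiff_mollify hv _, ?_, (hsub k).trans hδΩ⟩,
    ?_, ?_⟩
  · exact (IsCompact.cthickening hc).of_isClosed_subset (isClosed_tsupport _) (hsub k)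
  · refine tendsto_eLpNorm_two_of_bounded (C := C) (fun k => ?_)
      hv.continuous.aestronglyMeasurable (fun k => norm_mollify_le hC _) hC ?_
    · exact (contDiff_mollify hv _).continuous.aestronglyMeasurable
    · refine ae_restrict_of_ae ?_
      filter_upwards [ae_tendsto_mollify hv.continuous.locallyIntegrable] with x hx
      exact hx.comp (tendsto_add_atTop_nat k₀)
  · have e (k : ℕ) (x : Plane) : fderiv ℝ (mollify k v) x = ((mollifier k).normed volume
        ⋆[ContinuousLinearMap.lsmul ℝ ℝ, volume] (fderiv ℝ v)) x :=
      (hasFDerivAt_mollify hv k x).fderiv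
    have hb (x : Plane) : ‖fderiv ℝ v x‖ ≤ K := norm_fderiv_le_of_lipschitz ℝ hv
    refine tendsto_eLpNorm_two_of_bounded (C := K) (fun k => ?_)
      (stronglyMeasurable_gradient v).aestronglyMeasurable (fun k x => ?_) (norm_gradient_le hv) ?_
    · exact (stronglyMeasurable_gradient _).aestronglyMeasurable
    · rw [norm_gradient, e]
      exact norm_mollify_le hb _ x
    · refine ae_restrict_of_ae ?_
      filter_upwards [ae_tendsto_mollify (locallyIntegrable_fderiv hv)] with x hx
      have := hx.comp (tendsto_add_atTop_nat k₀)
      simp only [Function.comp_def, ← e] at this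
      exact ((LinearIsometryEquiv.continuous _).tendsto _).comp this

/-- The affine function `f · x` plus a Lipschitz function compactly supported in `Ω`. -/
lemma isAdmissible_of_lipschitz {Ω : Set Plane} (hΩ : IsOpen Ω) (hbdd : Bornology.IsBounded Ω)
    (f : Plane) (hv : LipschitzWith K v) (hc : HasCompactSupport v) (hs : tsupport v ⊆ Ω) :
    IsAdmissible Ω f (fun x => inner ℝ f x + v x) (fun x => f + gradient v x) := by
  have hfin : volume Ω ≠ ⊤ := hbdd.measure_lt_top.ne
  have hl : LipschitzWith ‖innerSL ℝ f‖₊ (fun x : Plane => inner ℝ f x) :=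
    (innerSL ℝ f).lipschitz
  have hη := hl.add hv
  obtain ⟨R, hR⟩ := hbdd.exists_norm_le
  obtain ⟨C, hC⟩ := hv.continuous.bounded_above_of_compact_support hc
  have hg : ∀ᵐ x, gradient (fun x => inner ℝ f x + v x) x = f + gradient v x := by
    filter_upwards [hv.ae_differentiableAt (μ := volume)] with x hx
    have h1 : HasGradientAt (fun x : Plane => inner ℝ f x) f x := by
      rw [hasGradientAt_iff_hasFDerivAt]
      exact (innerSL ℝ f).hasFDerivAt
    have h2 := (h1.hasFDerivAt.add hx.hasGradientAt.hasFDerivAt)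
    rw [← map_add] at h2
    exact (hasGradientAt_iff_hasFDerivAt.2 h2).gradient
  have hH := hasH1Gradient_of_lipschitz hfin hη ⟨‖f‖ * R + C, fun x hx => ?_⟩ hΩ.measurableSet
  · refine ⟨⟨hH.memLp, hH.memLp_grad.ae_eq (ae_restrict_of_ae hg), fun φ hφ => ?_⟩, ?_⟩
    · rw [hH.weak φ hφ]
      congr 1
      refine integral_congr_ae (ae_restrict_of_ae ?_)
      filter_upwards [hg] with x hx
      rw [hx]
    · simpa using vanishesOnBoundary_of_lipschitz hΩ hfin hv hc hs
  · refine (abs_add_le _ _).trans (add_le_add ((abs_real_inner_le_norm _ _).trans ?_) (hC x))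
    exact mul_le_mul_of_nonneg_left (hR x hx) (norm_nonneg _)

end Lipschitz

/-! ### Laminates have bounded variation -/

/-- A function which increases in direction `v` has a nonnegative distributional derivative in
that direction. -/
lemma integral_mul_fderiv_nonpos {P ψ : Plane → ℝ} (hP : LocallyIntegrable P volume) {v : Plane}
    (hmono : ∀ x, ∀ t : ℝ, 0 ≤ t → P x ≤ P (x + t • v)) (hψ : ContDiff ℝ 1 ψ)
    (hc : HasCompactSupport ψ) (h0 : ∀ x, 0 ≤ ψ x) :
    ∫ x, P x * fderiv ℝ ψ x v ≤ 0 := by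
  obtain ⟨L, hL⟩ := exists_lipschitzWith hψ hc
  -- `K` contains the support of every shift `ψ (· + t • v)` with `0 ≤ t ≤ 1`, so restricting `P` to
  -- `K` makes it integrable without changing the integrals.
  set K := Metric.cthickening ‖v‖ (tsupport ψ) with hK
  have hKc : IsCompact K := IsCompact.cthickening hc
  have hg : Integrable (K.indicator P) :=
    (integrable_indicator_iff hKc.measurableSet).2 (hP.integrableOn_isCompact hKc)
  have hlim := LipschitzWith.integral_inv_smul_sub_mul_tendsto_integral_lineDeriv_mul hL hg v
  have e : ∫ x, lineDeriv ℝ ψ x v * K.indicator P x = ∫ x, P x * fderiv ℝ ψ x v := by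
    refine integral_congr_ae (Eventually.of_forall fun x => ?_)
    simp only
    rw [((hψ.differentiable (by norm_num)) x).lineDeriv_eq_fderiv]
    by_cases hx : x ∈ K
    · rw [Set.indicator_of_mem hx, mul_comm]
    · have : fderiv ℝ ψ x = 0 := image_eq_zero_of_notMem_tsupport fun h =>
        hx (Metric.self_subset_cthickening _ (tsupport_fderiv_subset ℝ h))
      simp [this]
  rw [← e]
  refine le_of_tendsto hlim ?_
  filter_upwards [Ioc_mem_nhdsGT (zero_lt_one' ℝ)] with t ht
  have hi : Integrable (fun x => ψ x * P x) :=
    hP.integrable_smul_left_of_hasCompactSupport hψ.continuous hc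
  have hi' : Integrable (fun x => ψ (x + t • v) * P x) :=
    hP.integrable_smul_left_of_hasCompactSupport (hψ.continuous.comp (continuous_add_const _))
      (hc.comp_homeomorph (Homeomorph.addRight (t • v)))
  have hi'' : Integrable (fun x => ψ x * P (x - t • v)) := by
    have := hi'.comp_sub_right (t • v)
    simpa using this
  -- Translation invariance moves the difference quotient from `ψ` to `P`, where monotonicity gives
  -- it a sign.
  have e1 : ∫ x, (t⁻¹ • (ψ (x + t • v) - ψ x)) * K.indicator P x =
      t⁻¹ * ∫ x, ψ x * (P (x - t • v) - P x) := by
    have e2 : ∫ x, ψ (x + t • v) * P x = ∫ x, ψ x * P (x - t • v) := by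
      rw [← integral_add_right_eq_self (fun x => ψ x * P (x - t • v)) (t • v)]
      simp
    simp only [mul_sub]
    rw [integral_sub hi'' hi, ← e2, ← integral_sub hi' hi, ← integral_const_mul]
    refine integral_congr_ae (Eventually.of_forall fun x => ?_)
    simp only [smul_eq_mul]
    by_cases hx : x ∈ K
    · rw [Set.indicator_of_mem hx]; ring
    · have h1 : ψ x = 0 := image_eq_zero_of_notMem_tsupport fun h =>
        hx (Metric.self_subset_cthickening _ h)
      have h2 : ψ (x + t • v) = 0 := image_eq_zero_of_notMem_tsupport fun h => hx <| by
        refine Metric.mem_cthickening_of_dist_le x _ _ _ h ?_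
        rw [dist_eq_norm, sub_add_cancel_left, norm_neg, norm_smul, Real.norm_of_nonneg ht.1.le]
        exact mul_le_of_le_one_left (norm_nonneg _) ht.2
      simp [h1, h2]
  rw [e1]
  refine mul_nonpos_of_nonneg_of_nonpos (inv_nonneg.2 ht.1.le)
    (integral_nonpos fun x => mul_nonpos_of_nonneg_of_nonpos (h0 x) ?_)
  have := hmono (x - t • v) t ht.1.le
  rw [sub_add_cancel] at this
  simpa using this

lemma integrable_mul_fderiv {P ψ : Plane → ℝ} (hP : LocallyIntegrable P volume) (v : Plane)
    (hψ : ContDiff ℝ 1 ψ) (hc : HasCompactSupport ψ) :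
    Integrable (fun x => P x * fderiv ℝ ψ x v) :=
  hP.integrable_smul_right_of_hasCompactSupport
    ((hψ.continuous_fderiv (by norm_num)).clm_apply continuous_const) (hc.fderiv_apply ℝ v)

/-- A bump `ζ` equal to `1` on `Ω` dominates every admissible `ψ`. Both `ζ + ψ` and `ζ - ψ` are
nonnegative, so the sign of the directional derivative of `P` bounds the integral with `ψ` by the
one with `ζ`, which does not depend on `ψ`. -/
lemma exists_abs_integral_mul_fderiv_le {Ω : Set Plane} (hΩ : Bornology.IsBounded Ω)
    {P : Plane → ℝ} (hP : LocallyIntegrable P volume) {v : Plane}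
    (hmono : (∀ x, ∀ t : ℝ, 0 ≤ t → P x ≤ P (x + t • v)) ∨
      ∀ x, ∀ t : ℝ, 0 ≤ t → P x ≤ P (x + t • (-v))) :
    ∃ C : ℝ, ∀ ψ : Plane → ℝ, ContDiff ℝ 1 ψ → HasCompactSupport ψ → tsupport ψ ⊆ Ω →
      (∀ x, |ψ x| ≤ 1) → |∫ x, P x * fderiv ℝ ψ x v| ≤ C := by
  obtain ⟨R, hR0, hR⟩ := hΩ.exists_pos_norm_le
  let ζ : ContDiffBump (0 : Plane) := ⟨R, R + 1, hR0, by linarith⟩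
  have hζ : ContDiff ℝ 1 ζ := ζ.contDiff
  refine ⟨|∫ x, P x * fderiv ℝ ζ x v|, fun ψ hψ hc hs h1 => ?_⟩
  have hle (x : Plane) : |ψ x| ≤ ζ x := by
    by_cases hx : x ∈ tsupport ψ
    · rw [ζ.one_of_mem_closedBall (by simpa using hR x (hs hx))]
      exact h1 x
    · rw [image_eq_zero_of_notMem_tsupport hx, abs_zero]
      exact ζ.nonneg
  have hd (x : Plane) : DifferentiableAt ℝ ψ x := hψ.differentiable (by norm_num) x
  have hdζ (x : Plane) : DifferentiableAt ℝ ζ x := hζ.differentiable (by norm_num) x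
  have hiψ (w : Plane) := integrable_mul_fderiv hP w hψ hc
  have hiζ (w : Plane) := integrable_mul_fderiv hP w hζ ζ.hasCompactSupport
  have key (w : Plane) (hw : ∀ x, ∀ t : ℝ, 0 ≤ t → P x ≤ P (x + t • w)) :
      |∫ x, P x * fderiv ℝ ψ x w| ≤ |∫ x, P x * fderiv ℝ ζ x w| := by
    have a1 := integral_mul_fderiv_nonpos hP hw (hζ.add hψ) (ζ.hasCompactSupport.add hc)
      fun x => by simpa using (by linarith [neg_abs_le (ψ x), hle x] : 0 ≤ ζ x + ψ x)
    have a2 := integral_mul_fderiv_nonpos hP hw (hζ.sub hψ) (ζ.hasCompactSupport.sub hc)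
      fun x => by simpa using (by linarith [le_abs_self (ψ x), hle x] : ψ x ≤ ζ x)
    simp only [fderiv_fun_add (hdζ _) (hd _), fderiv_fun_sub (hdζ _) (hd _),
      add_apply, sub_apply, mul_add, mul_sub] at a1 a2
    rw [integral_add (hiζ w) (hiψ w)] at a1
    rw [integral_sub (hiζ w) (hiψ w)] at a2
    rw [abs_le]
    constructor <;> linarith [neg_abs_le (∫ x, P x * fderiv ℝ ζ x w)]
  rcases hmono with hm | hm
  · exact key v hm
  · simpa only [map_neg, mul_neg, integral_neg, abs_neg] using key (-v) hm

/-- The staircase function `⌊N n · x - b⌋`. -/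
def staircase (n : Plane) (N b : ℝ) (x : Plane) : ℝ := (⌊N * inner ℝ n x - b⌋ : ℝ)

lemma measurable_affine (n : Plane) (N b : ℝ) :
    Measurable (fun x : Plane => N * inner ℝ n x - b) := by
  have : Continuous (fun x : Plane => N * inner ℝ n x - b) := by fun_prop
  exact this.measurable

lemma locallyIntegrable_staircase (n : Plane) (N b : ℝ) :
    LocallyIntegrable (staircase n N b) volume := by
  have e : staircase n N b =
      (fun x => N * inner ℝ n x - b) - fun x => Int.fract (N * inner ℝ n x - b) := by
    ext x
    simp [staircase, Int.self_sub_fract]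
  have hc : Continuous (fun x : Plane => N * inner ℝ n x - b) := by fun_prop
  rw [e]
  refine hc.locallyIntegrable.sub (MemLp.locallyIntegrable (p := ⊤) ?_ le_top)
  refine memLp_top_of_bound (hc.measurable.fract).aestronglyMeasurable 1
    (Eventually.of_forall fun x => ?_)
  rw [Real.norm_of_nonneg (Int.fract_nonneg _)]
  exact (Int.fract_lt_one _).le

lemma staircase_monotone (n : Plane) (N b : ℝ) (v : Plane) :
    (∀ x, ∀ t : ℝ, 0 ≤ t → staircase n N b x ≤ staircase n N b (x + t • v)) ∨
      ∀ x, ∀ t : ℝ, 0 ≤ t → staircase n N b x ≤ staircase n N b (x + t • (-v)) := by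
  have key (w : Plane) (hw : 0 ≤ N * inner ℝ n w) (x : Plane) (t : ℝ) (ht : 0 ≤ t) :
      staircase n N b x ≤ staircase n N b (x + t • w) := by
    unfold staircase
    rw [inner_add_right, real_inner_smul_right]
    exact_mod_cast Int.floor_le_floor (by nlinarith [mul_nonneg ht hw])
  rcases le_total 0 (N * inner ℝ n v) with h | h
  · exact Or.inl (key v h)
  · refine Or.inr (key (-v) ?_)
    rw [inner_neg_right]; linarith

/-- Lowering `s` by `θ` crosses an integer exactly when the fractional part of `s` is below `θ`.
Bounded variation of laminates then follows from that of staircases. -/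
lemma laminate_eq {θ : ℝ} (hθ : θ ∈ Set.Icc (0 : ℝ) 1) (n : Plane) (N : ℝ) (x : Plane) :
    laminate n N θ x = staircase n N 0 x - staircase n N θ x := by
  unfold laminate staircase
  set s := N * inner ℝ n x
  have h0 := Int.fract_nonneg s
  have h1 := Int.fract_lt_one s
  have h2 := Int.floor_add_fract s
  rw [sub_zero]
  split_ifs with h
  · have : ⌊s - θ⌋ = ⌊s⌋ - 1 := by
      rw [Int.floor_eq_iff]; push_cast
      constructor <;> linarith [hθ.2]
    rw [this]; push_cast; ring
  · have : ⌊s - θ⌋ = ⌊s⌋ := by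
      rw [Int.floor_eq_iff]
      constructor <;> linarith [hθ.1]
    rw [this]; ring

lemma laminate_zero_or_one (n : Plane) (N θ : ℝ) (x : Plane) :
    laminate n N θ x = 0 ∨ laminate n N θ x = 1 := by
  unfold laminate; split_ifs <;> simp

lemma measurable_laminate (n : Plane) (N θ : ℝ) : Measurable (laminate n N θ) := by
  have h := (measurable_affine n N 0).fract
  simp only [sub_zero] at h
  exact Measurable.ite (measurableSet_lt h measurable_const) measurable_const measurable_const

lemma memBV_laminate {Ω : Set Plane} (hΩ : Bornology.IsBounded Ω) {θ : ℝ}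
    (hθ : θ ∈ Set.Icc (0 : ℝ) 1) (n : Plane) (N : ℝ) : MemBV Ω (laminate n N θ) := by
  have : IsFiniteMeasure (volume.restrict Ω) := ⟨by simpa using hΩ.measure_lt_top⟩
  refine ⟨?_, ?_⟩
  · refine Integrable.of_bound (measurable_laminate n N θ).aestronglyMeasurable 1
      (Eventually.of_forall fun x => ?_)
    rcases laminate_zero_or_one n N θ x with h | h <;> simp [h]
  have hb (b : ℝ) (i : Fin 2) := exists_abs_integral_mul_fderiv_le hΩ
    (locallyIntegrable_staircase n N b) (staircase_monotone n N b (EuclideanSpace.single i 1))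
  choose C hC using hb
  refine ⟨∑ i, (C 0 i + C θ i), fun Φ hΦ hc hs h1 => ?_⟩
  have hψ (i : Fin 2) : ContDiff ℝ 1 (fun x => Φ x i) := by fun_prop
  have hsub (i : Fin 2) : tsupport (fun x => Φ x i) ⊆ tsupport Φ :=
    closure_mono fun x hx hx' => hx (by simp [hx'])
  have hψc (i : Fin 2) : HasCompactSupport (fun x => Φ x i) :=
    hc.of_isClosed_subset (isClosed_tsupport _) (hsub i)
  have hψ1 (i : Fin 2) (x : Plane) : |Φ x i| ≤ 1 := (PiLp.norm_apply_le (Φ x) i).trans (h1 x)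
  have hdiv (x : Plane) : divergence Φ x =
      ∑ i, fderiv ℝ (fun x => Φ x i) x (EuclideanSpace.single i 1) := by
    refine Finset.sum_congr rfl fun i _ => ?_
    have h := ((EuclideanSpace.proj i : Plane →L[ℝ] ℝ).hasFDerivAt).comp x
      ((hΦ.differentiable (by norm_num)) x).hasFDerivAt
    have h' : HasFDerivAt (fun x => Φ x i) _ x := h
    rw [h'.fderiv]; rfl
  have hint (b : ℝ) (i : Fin 2) := integrable_mul_fderiv (locallyIntegrable_staircase n N b)
    (EuclideanSpace.single i 1) (hψ i) (hψc i)
  rw [setIntegral_eq_integral_of_forall_compl_eq_zero]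
  · have e : ∀ x, laminate n N θ x * divergence Φ x = ∑ i,
        (staircase n N 0 x * fderiv ℝ (fun x => Φ x i) x (EuclideanSpace.single i 1) -
          staircase n N θ x * fderiv ℝ (fun x => Φ x i) x (EuclideanSpace.single i 1)) := by
      intro x
      rw [laminate_eq hθ, hdiv, Finset.mul_sum]
      simp only [sub_mul]
    simp only [e]
    rw [integral_finsetSum _ fun i _ => by exact (hint 0 i).sub (hint θ i)]
    refine Finset.sum_le_sum fun i _ => ?_
    rw [integral_sub (hint 0 i) (hint θ i)]
    have a := hC 0 i _ (hψ i) (hψc i) ((hsub i).trans hs) (hψ1 i)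
    have b := hC θ i _ (hψ i) (hψc i) ((hsub i).trans hs) (hψ1 i)
    linarith [(abs_le.1 a).2, (abs_le.1 b).1]
  · intro x hx
    have : fderiv ℝ Φ x = 0 := image_eq_zero_of_notMem_tsupport fun h =>
      hx (hs (tsupport_fderiv_subset ℝ h))
    simp [divergence, this]

/-! ### The sawtooth function -/

/-- The `1`-periodic function with slopes `θ - 1` on `[0, θ]` and `θ` on `[θ, 1]`. -/
def sawtooth (θ s : ℝ) : ℝ := θ * Int.fract s - min (Int.fract s) θ

lemma abs_sawtooth_le {θ : ℝ} (hθ : θ ∈ Set.Icc (0 : ℝ) 1) (s : ℝ) : |sawtooth θ s| ≤ 1 := by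
  unfold sawtooth
  have h0 := Int.fract_nonneg s
  have h1 := (Int.fract_lt_one s).le
  obtain ⟨h2, h3⟩ := hθ
  rw [abs_le]
  rcases min_cases (Int.fract s) θ with ⟨h, h'⟩ | ⟨h, h'⟩ <;> rw [h] <;> constructor <;>
    nlinarith [mul_nonneg h0 h2]

lemma sawtooth_sub_mem {θ : ℝ} (hθ : θ ∈ Set.Icc (0 : ℝ) 1) {s t : ℝ} (hst : s ≤ t) :
    |sawtooth θ s - sawtooth θ t| ≤ t - s := by
  obtain ⟨h2, h3⟩ := hθ
  have hs0 := Int.fract_nonneg s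
  have hs1 := (Int.fract_lt_one s).le
  have ht0 := Int.fract_nonneg t
  have ht1 := (Int.fract_lt_one t).le
  have es : (⌊s⌋ : ℝ) = s - Int.fract s := by linarith [Int.floor_add_fract s]
  have et : (⌊t⌋ : ℝ) = t - Int.fract t := by linarith [Int.floor_add_fract t]
  -- This quantity is the length of the first phase in `[s, t]`. The sawtooth increment is its
  -- difference from `θ (t - s)`, and both numbers lie in `[0, t - s]`.
  have hG : 0 ≤ θ * (⌊t⌋ - ⌊s⌋ : ℝ) + (min (Int.fract t) θ - min (Int.fract s) θ) ∧
      θ * (⌊t⌋ - ⌊s⌋ : ℝ) + (min (Int.fract t) θ - min (Int.fract s) θ) ≤ t - s := by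
    rcases (Int.floor_le_floor hst).eq_or_lt with h | h
    · rw [h, sub_self, mul_zero, zero_add]
      rw [← h, es] at et
      rcases min_cases (Int.fract s) θ with ⟨h, h'⟩ | ⟨h, h'⟩ <;>
      rcases min_cases (Int.fract t) θ with ⟨k, k'⟩ | ⟨k, k'⟩ <;> rw [h, k] <;>
      constructor <;> linarith
    · have h' : (1 : ℝ) ≤ ⌊t⌋ - ⌊s⌋ := by
        have : ⌊s⌋ + 1 ≤ ⌊t⌋ := h
        have : ((⌊s⌋ + 1 : ℤ) : ℝ) ≤ ⌊t⌋ := by exact_mod_cast this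
        push_cast at this; linarith
      have e : t - s = (⌊t⌋ - ⌊s⌋ : ℝ) + (Int.fract t - Int.fract s) := by rw [es, et]; ring
      rw [e]
      have m1 := mul_le_mul_of_nonneg_left h' h2
      have m2 := mul_le_mul_of_nonneg_left h' (sub_nonneg.2 h3)
      rcases min_cases (Int.fract s) θ with ⟨h, h'⟩ | ⟨h, h'⟩ <;>
      rcases min_cases (Int.fract t) θ with ⟨k, k'⟩ | ⟨k, k'⟩ <;> rw [h, k] <;>
      constructor <;> linarith
  have e : sawtooth θ s - sawtooth θ t = (θ * (⌊t⌋ - ⌊s⌋ : ℝ) +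
      (min (Int.fract t) θ - min (Int.fract s) θ)) - θ * (t - s) := by
    rw [es, et]; unfold sawtooth; ring
  have m1 : 0 ≤ θ * (t - s) := mul_nonneg h2 (by linarith)
  have m2 : 0 ≤ (1 - θ) * (t - s) := mul_nonneg (by linarith) (by linarith)
  rw [e, abs_le]
  constructor <;> linarith [hG.1, hG.2]

lemma lipschitzWith_sawtooth {θ : ℝ} (hθ : θ ∈ Set.Icc (0 : ℝ) 1) :
    LipschitzWith 1 (sawtooth θ) := by
  refine LipschitzWith.of_dist_le_mul fun s t => ?_
  rw [Real.dist_eq, Real.dist_eq, NNReal.coe_one, one_mul]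
  rcases le_total s t with h | h
  · rw [abs_sub_comm s t, abs_of_nonneg (sub_nonneg.2 h)]
    exact sawtooth_sub_mem hθ h
  · rw [abs_sub_comm, abs_of_nonneg (sub_nonneg.2 h)]
    exact sawtooth_sub_mem hθ h

lemma hasDerivAt_sawtooth {θ s : ℝ} (h0 : Int.fract s ≠ 0) (hs : Int.fract s ≠ θ) :
    HasDerivAt (sawtooth θ) (θ - if Int.fract s < θ then 1 else 0) s := by
  have hpos : 0 < Int.fract s := lt_of_le_of_ne (Int.fract_nonneg s) (Ne.symm h0)
  have e0 := Int.floor_add_fract s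
  have hfl : ∀ᶠ u : ℝ in 𝓝 s, Int.fract u = u - ⌊s⌋ := by
    filter_upwards [Ioo_mem_nhds (show (⌊s⌋ : ℝ) < s by linarith)
      (show s < (⌊s⌋ : ℝ) + 1 from Int.lt_floor_add_one s)] with u hu
    rw [← Int.self_sub_floor, Int.floor_eq_iff.2 ⟨hu.1.le, hu.2⟩]
  have hd : HasDerivAt (fun u : ℝ => u - ⌊s⌋) 1 s := (hasDerivAt_id s).sub_const _
  split_ifs with h
  · have : sawtooth θ =ᶠ[𝓝 s] fun u => θ * (u - ⌊s⌋) - (u - ⌊s⌋) := by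
      filter_upwards [hfl, Iio_mem_nhds (show s < ⌊s⌋ + θ by linarith)] with u hu hu'
      have : u - ⌊s⌋ ≤ θ := by linarith [Set.mem_Iio.1 hu']
      rw [sawtooth, hu, min_eq_left this]
    exact (((hd.const_mul θ).sub hd).congr_of_eventuallyEq this).congr_deriv (by ring)
  · have h' : θ < Int.fract s := lt_of_le_of_ne (not_lt.1 h) (Ne.symm hs)
    have : sawtooth θ =ᶠ[𝓝 s] fun u => θ * (u - ⌊s⌋) - θ := by
      filter_upwards [hfl, Ioi_mem_nhds (show ⌊s⌋ + θ < s by linarith)] with u hu hu'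
      have : θ ≤ u - ⌊s⌋ := by linarith [Set.mem_Ioi.1 hu']
      rw [sawtooth, hu, min_eq_right this]
    exact (((hd.const_mul θ).sub_const θ).congr_of_eventuallyEq this).congr_deriv (by ring)

/-! ### Interfaces are negligible -/

/-- The exceptional set is the preimage of a countable subset of `ℝ` under a surjective linear map.
-/
lemma ae_fract_ne {n : Plane} (hn : ‖n‖ = 1) {N : ℝ} (hN : N ≠ 0) (b : ℝ) :
    ∀ᵐ x : Plane, Int.fract (N * inner ℝ n x) ≠ b := by
  let L : Plane →ₗ[ℝ] ℝ := (N • innerSL ℝ n : Plane →L[ℝ] ℝ)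
  have hL (x : Plane) : L x = N * inner ℝ n x := rfl
  have hsurj : Function.Surjective L := fun s => by
    refine ⟨(s / N) • n, ?_⟩
    rw [hL, real_inner_smul_right, real_inner_self_eq_norm_sq, hn]
    field_simp
  have hs : MeasurableSet {s : ℝ | Int.fract s ≠ b} :=
    (measurableSet_eq_fun measurable_fract measurable_const).compl
  refine (ae_comp_linearMap_mem_iff L volume volume hsurj hs).2 ?_
  have : (Set.range fun m : ℤ => (m : ℝ) + b).Countable := Set.countable_range _
  filter_upwards [this.ae_notMem volume] with s hs' h
  exact hs' ⟨⌊s⌋, by simp only [← h, Int.floor_add_fract]⟩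

/-- The gradient of the piecewise affine function that oscillates with the laminate. -/
lemma ae_hasGradientAt_sawtooth {n : Plane} (hn : ‖n‖ = 1) {N : ℝ} (hN : N ≠ 0) (θ : ℝ) :
    ∀ᵐ x : Plane, HasGradientAt (fun x : Plane => sawtooth θ (N * inner ℝ n x) / N)
      ((θ - laminate n N θ x) • n) x := by
  filter_upwards [ae_fract_ne hn hN 0, ae_fract_ne hn hN θ] with x h0 h1
  have hd := hasDerivAt_sawtooth h0 h1
  have hl : HasFDerivAt (fun x : Plane => N * inner ℝ n x) (N • innerSL ℝ n) x :=
    (N • innerSL ℝ n : Plane →L[ℝ] ℝ).hasFDerivAt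
  have h := (hd.comp_hasFDerivAt x hl).const_mul N⁻¹
  rw [hasGradientAt_iff_hasFDerivAt]
  refine (h.congr_fderiv ?_).congr_of_eventuallyEq (Eventually.of_forall fun y => ?_)
  · ext w
    simp [laminate]
    field_simp
  · simp only [Function.comp_apply]
    field_simp

lemma lipschitzWith_sawtooth_inner {n : Plane} (hn : ‖n‖ = 1) {N : ℝ} (hN : 0 < N) {θ : ℝ}
    (hθ : θ ∈ Set.Icc (0 : ℝ) 1) :
    LipschitzWith 1 (fun x : Plane => sawtooth θ (N * inner ℝ n x) / N) := by
  refine LipschitzWith.of_dist_le_mul fun x y => ?_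
  have h := (lipschitzWith_sawtooth hθ).dist_le_mul (N * inner ℝ n x) (N * inner ℝ n y)
  rw [Real.dist_eq, Real.dist_eq, ← mul_sub, ← inner_sub_right, abs_mul, abs_of_pos hN] at h
  have h' := abs_real_inner_le_norm n (x - y)
  rw [hn, one_mul] at h'
  rw [Real.dist_eq, ← sub_div, abs_div, abs_of_pos hN, div_le_iff₀ hN, dist_eq_norm]
  simp only [NNReal.coe_one, one_mul] at h ⊢
  nlinarith

/-! ### The volume fraction -/

/-- Interfaces are null, so by dominated convergence the integral is continuous in `θ`. It runs from
`0` at `θ = 0` to the full volume at `θ = 1`. -/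
lemma exists_laminate_average {Ω : Set Plane} (hfin : volume Ω ≠ ⊤) {n : Plane} (hn : ‖n‖ = 1)
    {N : ℝ} (hN : N ≠ 0) {d : ℝ} (hd : d ∈ Set.Icc (0 : ℝ) 1) :
    ∃ θ ∈ Set.Icc (0 : ℝ) 1, ∫ x in Ω, laminate n N θ x = volume.real Ω * d := by
  have : IsFiniteMeasure (volume.restrict Ω) := ⟨by simpa using hfin.lt_top⟩
  have hcont : Continuous fun θ : ℝ => ∫ x in Ω, laminate n N θ x := by
    refine continuous_iff_continuousAt.2 fun θ => ?_
    refine continuousAt_of_dominated (bound := fun _ => 1)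
      (Eventually.of_forall fun t => (measurable_laminate n N t).aestronglyMeasurable)
      (Eventually.of_forall fun t => Eventually.of_forall fun x => ?_) (integrable_const _) ?_
    · rcases laminate_zero_or_one n N t x with h | h <;> simp [h]
    · refine ae_restrict_of_ae ?_
      filter_upwards [ae_fract_ne hn hN θ] with x hx
      refine (continuousAt_const (y := laminate n N θ x)).congr ?_
      rcases lt_or_gt_of_ne hx with h | h
      · filter_upwards [Ioi_mem_nhds h] with t ht
        have ht : Int.fract (N * inner ℝ n x) < t := ht
        simp [laminate, h, ht]
      · filter_upwards [Iio_mem_nhds h] with t ht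
        have ht : t < Int.fract (N * inner ℝ n x) := ht
        simp [laminate, not_lt.2 h.le, not_lt.2 ht.le]
  have h0 : ∫ x in Ω, laminate n N 0 x = 0 := by
    have : ∀ x, laminate n N 0 x = 0 := fun x => by
      simp [laminate, not_lt.2 (Int.fract_nonneg _)]
    simp [this]
  have h1 : ∫ x in Ω, laminate n N 1 x = volume.real Ω := by
    have : ∀ x, laminate n N 1 x = 1 := fun x => by
      simp [laminate, Int.fract_lt_one]
    simp [this]
  refine intermediate_value_Icc zero_le_one hcont.continuousOn ?_
  simp only [h0, h1]
  have hv : 0 ≤ volume.real Ω := measureReal_nonneg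
  exact ⟨mul_nonneg hv hd.1, mul_le_of_le_one_right hv hd.2⟩

/-! ### Boundary collars and equidistribution of fine layers -/

/-- The collar of points of `Ω` at distance at most `δ` from the boundary. -/
def collar (Ω : Set Plane) (δ : ℝ) : Set Plane := {x ∈ Ω | Metric.infDist x Ωᶜ ≤ δ}

lemma measurableSet_collar {Ω : Set Plane} (hΩ : IsOpen Ω) (δ : ℝ) : MeasurableSet (collar Ω δ) :=
  hΩ.measurableSet.inter
    (measurableSet_le (Metric.continuous_infDist_pt _).measurable measurable_const)

/-- This excludes the default value `0` of `Metric.infDist` to the empty set, so that points of `Ω`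
have positive distance to `Ωᶜ`. -/
lemma compl_nonempty_of_isBounded {Ω : Set Plane} (hbdd : Bornology.IsBounded Ω) :
    Ωᶜ.Nonempty := by
  rw [Set.nonempty_compl]
  rintro rfl
  exact NormedSpace.unbounded_univ ℝ Plane hbdd

/-- Continuity from above of a finite measure: the collars decrease to the empty set because `Ω` is
open. -/
lemma tendsto_volume_collar {Ω : Set Plane} (hΩ : IsOpen Ω) (hbdd : Bornology.IsBounded Ω) :
    Tendsto (fun δ => volume (collar Ω δ)) (𝓝[>] 0) (𝓝 0) := by
  have h := tendsto_measure_biInter_gt (μ := volume) (s := collar Ω) (a := (0 : ℝ))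
    (fun r _ => (measurableSet_collar hΩ r).nullMeasurableSet)
    (fun i j _ hij x hx => ⟨hx.1, hx.2.trans hij⟩)
    ⟨1, one_pos, ((hbdd.subset (Set.sep_subset _ _)).measure_lt_top).ne⟩
  have e : ⋂ r > 0, collar Ω r = ∅ := by
    refine Set.eq_empty_of_forall_notMem fun x hx => ?_
    simp only [Set.mem_iInter] at hx
    have hxΩ : x ∉ Ωᶜ := fun h' => h' (hx 1 one_pos).1
    have hp := (hΩ.isClosed_compl.notMem_iff_infDist_pos (compl_nonempty_of_isBounded hbdd)).1 hxΩ
    linarith [(hx _ (half_pos hp)).2]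
  rw [e, measure_empty] at h
  exact h

/-- The factor `θ - χ` is the derivative along `n` of a sawtooth of size at most `1 / (k + 1)`.
Integrating by parts moves this derivative to `ψ`. -/
lemma tendsto_integral_laminate_sub_mul {n : Plane} (hn : ‖n‖ = 1) {θ : ℕ → ℝ}
    (hθ : ∀ k, θ k ∈ Set.Icc (0 : ℝ) 1) {ψ : Plane → ℝ} {L : NNReal} (hψ : LipschitzWith L ψ)
    (hc : HasCompactSupport ψ) :
    Tendsto (fun k : ℕ => ∫ x, (θ k - laminate n (k + 1) (θ k) x) * ψ x) atTop (𝓝 0) := by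
  set C := ∫ x, ‖fderiv ℝ ψ x n‖
  have hi : Integrable (fun x => fderiv ℝ ψ x n) := by
    refine ((integrableOn_iff_integrable_of_support_subset (s := tsupport ψ) ?_).1 ?_)
    · intro x hx
      by_contra h
      have : fderiv ℝ ψ x = 0 :=
        image_eq_zero_of_notMem_tsupport fun h' => h (tsupport_fderiv_subset ℝ h')
      exact hx (by simp [this])
    · refine IntegrableOn.of_bound hc.measure_lt_top
        (measurable_fderiv_apply_const ℝ ψ n).aestronglyMeasurable L
        (Eventually.of_forall fun x => ?_)
      refine (ContinuousLinearMap.le_opNorm _ _).trans ?_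
      rw [hn, mul_one]
      exact norm_fderiv_le_of_lipschitz ℝ hψ
  have hb : Tendsto (fun k : ℕ => 1 / ((k : ℝ) + 1) * C) atTop (𝓝 0) := by
    simpa using tendsto_one_div_add_atTop_nhds_zero_nat.mul_const C
  refine squeeze_zero_norm (fun k => ?_) hb
  have hN : (0 : ℝ) < k + 1 := by positivity
  have h := integral_fderiv_mul_eq (lipschitzWith_sawtooth_inner hn hN (hθ k)) hψ hc n
  have e : ∫ x, (θ k - laminate n (k + 1) (θ k) x) * ψ x =
      ∫ x, fderiv ℝ (fun x : Plane => sawtooth (θ k) ((k + 1) * inner ℝ n x) / (k + 1)) x n * ψ x := by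
    refine integral_congr_ae ?_
    filter_upwards [ae_hasGradientAt_sawtooth hn hN.ne' (θ k)] with x hx
    rw [hx.fderiv_apply, real_inner_smul_left, real_inner_self_eq_norm_sq, hn]
    ring
  rw [e, h, norm_neg]
  refine (norm_integral_le_of_norm_le (hi.norm.mul_const (1 / ((k : ℝ) + 1)))
    (Eventually.of_forall fun x => ?_)).trans (le_of_eq ?_)
  · rw [norm_mul, norm_div, Real.norm_of_nonneg hN.le]
    gcongr
    exact abs_sawtooth_le (hθ k) _
  · rw [integral_mul_const, mul_comm]

/-- Layers become equidistributed as they become finer. -/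
lemma tendsto_fraction {Ω : Set Plane} (hΩ : IsOpen Ω) (hbdd : Bornology.IsBounded Ω)
    (hne : Ω.Nonempty) {n : Plane} (hn : ‖n‖ = 1) {θ : ℕ → ℝ} {d : ℝ}
    (hθ : ∀ k, θ k ∈ Set.Icc (0 : ℝ) 1)
    (hd : ∀ k : ℕ, ∫ x in Ω, laminate n (k + 1) (θ k) x = volume.real Ω * d) :
    Tendsto θ atTop (𝓝 d) := by
  have hfin : volume Ω ≠ ⊤ := hbdd.measure_lt_top.ne
  have : IsFiniteMeasure (volume.restrict Ω) := ⟨by simpa using hfin.lt_top⟩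
  have hpos : 0 < volume.real Ω := ENNReal.toReal_pos (hΩ.measure_pos volume hne).ne' hfin
  have hlim : Tendsto (fun k => volume.real Ω * (θ k - d)) atTop (𝓝 0) := by
    rw [Metric.tendsto_atTop']
    intro ε hε
    have hcol := ((tendsto_volume_collar hΩ hbdd).eventually
      (gt_mem_nhds (ENNReal.ofReal_pos.2 (half_pos hε)))).and self_mem_nhdsWithin
    obtain ⟨δ, hδ, hδ0 : 0 < δ⟩ := hcol.exists
    have hδ' : volume.real (collar Ω δ) < ε / 2 := by
      rwa [Measure.real, ← ENNReal.lt_ofReal_iff_toReal_lt (ne_top_of_lt hδ)]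
    -- A Lipschitz cutoff, zero outside `Ω` and one on `Ω` off the collar: oscillation controls the
    -- integral against `ψ`, and the collar volume controls the remainder.
    set ψ : Plane → ℝ := fun x => min 1 (δ⁻¹ * Metric.infDist x Ωᶜ) with hψdef
    have hψL : LipschitzWith (max 0 (‖δ⁻¹‖₊ * 1)) ψ :=
      (LipschitzWith.const 1).min ((lipschitzWith_smul δ⁻¹).comp (Metric.lipschitz_infDist_pt Ωᶜ))
    have hψ0 (x : Plane) (hx : x ∉ Ω) : ψ x = 0 := by
      simp [hψdef, Metric.infDist_zero_of_mem (show x ∈ Ωᶜ from hx)]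
    have hψc : HasCompactSupport ψ :=
      HasCompactSupport.of_support_subset_isCompact hbdd.isCompact_closure fun x hx =>
        subset_closure (by_contra fun h => hx (hψ0 x h))
    have hψ1 (x : Plane) : 0 ≤ ψ x ∧ ψ x ≤ 1 :=
      ⟨le_min zero_le_one (mul_nonneg (inv_nonneg.2 hδ0.le) Metric.infDist_nonneg),
        min_le_left _ _⟩
    obtain ⟨k₀, hk₀⟩ := Metric.tendsto_atTop.1 (tendsto_integral_laminate_sub_mul hn hθ hψL hψc)
      (ε / 2) (half_pos hε)
    refine ⟨k₀, fun k hk => ?_⟩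
    have h1 := hk₀ k hk.le
    rw [Real.dist_eq, sub_zero] at h1 ⊢
    set χ := laminate n (k + 1) (θ k)
    have hχi : Integrable χ (volume.restrict Ω) := (memBV_laminate hbdd (hθ k) n (k + 1)).integrable
    have hχb (x : Plane) : |θ k - χ x| ≤ 1 := by
      have := hθ k
      rw [abs_le]
      rcases laminate_zero_or_one n (k + 1) (θ k) x with h | h <;> simp only [χ, h] <;>
        constructor <;> linarith [this.1, this.2]
    have hi1 : Integrable (fun x => θ k - χ x) (volume.restrict Ω) := (integrable_const _).sub hχi
    have hψi : Integrable ψ (volume.restrict Ω) :=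
      (hψL.continuous.integrable_of_hasCompactSupport hψc).restrict
    have hi2 : Integrable (fun x => (θ k - χ x) * ψ x) (volume.restrict Ω) :=
      hψi.bdd_mul (c := 1) hi1.aestronglyMeasurable (Eventually.of_forall hχb)
    have e1 : volume.real Ω * (θ k - d) = ∫ x in Ω, (θ k - χ x) := by
      rw [integral_sub (integrable_const _) hχi, hd k, integral_const]
      simp only [measureReal_restrict_apply_univ, smul_eq_mul]; ring
    have e2 : ∫ x in Ω, (θ k - χ x) =
        (∫ x, (θ k - χ x) * ψ x) + ∫ x in Ω, ((θ k - χ x) - (θ k - χ x) * ψ x) := by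
      rw [integral_sub hi1 hi2, setIntegral_eq_integral_of_forall_compl_eq_zero
        (f := fun x => (θ k - χ x) * ψ x) fun x hx => by rw [hψ0 x hx, mul_zero]]
      ring
    have h2 : |∫ x in Ω, ((θ k - χ x) - (θ k - χ x) * ψ x)| ≤ volume.real (collar Ω δ) := by
      have hcm := measurableSet_collar hΩ δ
      have hb := norm_integral_le_of_norm_le (μ := volume.restrict Ω)
        (f := fun x => (θ k - χ x) - (θ k - χ x) * ψ x)
        (g := (collar Ω δ).indicator fun _ => (1 : ℝ))
        ((integrable_const (1 : ℝ)).indicator hcm)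
        ((ae_restrict_iff' hΩ.measurableSet).2 (Eventually.of_forall fun x hx => ?_))
      · refine hb.trans (le_of_eq ?_)
        rw [integral_indicator hcm, Measure.restrict_restrict hcm, Set.inter_eq_left.2
          (show collar Ω δ ⊆ Ω from fun x hx => hx.1), integral_const]
        simp
      · have e : (θ k - χ x) - (θ k - χ x) * ψ x = (θ k - χ x) * (1 - ψ x) := by ring
        rw [e, norm_mul]
        by_cases hxc : x ∈ collar Ω δ
        · rw [Set.indicator_of_mem hxc]
          refine mul_le_one₀ (hχb x) (norm_nonneg _) ?_
          rw [Real.norm_of_nonneg (sub_nonneg.2 (hψ1 x).2)]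
          linarith [(hψ1 x).1]
        · have : δ < Metric.infDist x Ωᶜ := not_le.1 fun h => hxc ⟨hx, h⟩
          have : ψ x = 1 := min_eq_left (by
            rw [inv_mul_eq_div, le_div_iff₀ hδ0]; linarith)
          simp [this, Set.indicator_of_notMem hxc]
    rw [e1, e2]
    refine (abs_add_le _ _).trans_lt ?_
    linarith
  have := (hlim.const_mul (volume.real Ω)⁻¹).add_const d
  simp only [mul_zero, zero_add] at this
  refine this.congr fun k => ?_
  rw [inv_mul_cancel_left₀ hpos.ne', sub_add_cancel]

/-! ### Optimality of the rank-one laminate -/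

/-- Cutting off a Lipschitz function near `∂Ω` by truncation at the distance to the boundary. -/
lemma exists_truncation {Ω : Set Plane} (hbdd : Bornology.IsBounded Ω)
    {v : Plane → ℝ} {K : NNReal} (hv : LipschitzWith K v) {δ M : ℝ} (hδ : 0 < δ)
    (hM : ∀ x ∈ Ω, |v x| ≤ M) :
    ∃ u : Plane → ℝ, LipschitzWith (max K 1) u ∧ HasCompactSupport u ∧ tsupport u ⊆ Ω ∧
      ∀ x ∈ Ω, x ∉ collar Ω (δ + M) → u =ᶠ[𝓝 x] v := by
  set g : Plane → ℝ := fun x => max (Metric.infDist x Ωᶜ - δ) 0 with hg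
  have hgL : LipschitzWith 1 g := by
    have h := (Metric.lipschitz_infDist_pt Ωᶜ).sub (LipschitzWith.const (α := Plane) δ)
    rw [add_zero] at h
    exact h.max_const 0
  have hg0 (x : Plane) : 0 ≤ g x := le_max_right _ _
  -- `u` clamps `v` to `[-g, g]`. It vanishes within distance `δ` of the complement and equals `v`
  -- wherever `|v| < g`, at no cost beyond the Lipschitz constant `max K 1`.
  set u : Plane → ℝ := fun x => max (min (v x) (g x)) (-g x) with hu
  have huL : LipschitzWith (max K 1) u := by
    simpa using (hv.min hgL).max hgL.neg
  have hsupp : tsupport u ⊆ {x | δ ≤ Metric.infDist x Ωᶜ} := by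
    refine closure_minimal (fun x hx => ?_)
      (isClosed_le continuous_const (Metric.continuous_infDist_pt _))
    by_contra h
    have h : Metric.infDist x Ωᶜ < δ := not_le.1 h
    have : g x = 0 := max_eq_right (by linarith)
    refine hx ?_
    simp only [hu, this, neg_zero]
    exact max_eq_right (min_le_right _ _)
  have hsub : tsupport u ⊆ Ω := fun x hx => by
    by_contra h
    have := Metric.infDist_zero_of_mem (show x ∈ Ωᶜ from h)
    have := hsupp hx
    simp only [Set.mem_ofPred_eq] at this
    linarith
  refine ⟨u, huL, ?_, hsub, fun x hx hxc => ?_⟩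
  · exact Metric.isCompact_of_isClosed_isBounded (isClosed_tsupport u) (hbdd.subset hsub)
  · have h1 : δ + M < Metric.infDist x Ωᶜ := not_le.1 fun h => hxc ⟨hx, h⟩
    have h2 : |v x| < g x := lt_of_lt_of_le (by linarith [hM x hx]) (le_max_left _ _)
    -- The strict inequality persists nearby, so `u` and `v` agree as germs and have the same
    -- gradient.
    filter_upwards [hv.continuous.abs.continuousAt.eventually_lt hgL.continuous.continuousAt h2]
      with y hy
    have := abs_lt.1 hy
    simp only [hu]
    rw [min_eq_left this.2.le, max_eq_left this.1.le]

lemma exists_abs_phaseEnergy_le_of_norm_le (α : Matrix (Fin 2) (Fin 2) ℝ) (fT : Plane) (w B : ℝ) :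
    ∃ D : ℝ, ∀ v, ‖v‖ ≤ B → |phaseEnergy α fT w v| ≤ D := by
  obtain ⟨D, hD⟩ := (isCompact_closedBall (0 : Plane) B).exists_bound_of_continuousOn
    (continuous_phaseEnergy α fT w).continuousOn
  exact ⟨D, fun v hv => hD v (by simpa using hv)⟩

/-- If bounded gradients take the values `a₁` and `a₂` in the two phases up to sets of vanishing
measure, then the energies converge to the mixture of the values at `a₁` and `a₂`. -/
lemma tendsto_averageEnergy {Ω : Set Plane} (hΩ : MeasurableSet Ω) (hfin : volume Ω ≠ ⊤)
    (h0 : volume Ω ≠ 0) {α₁ α₂ : Matrix (Fin 2) (Fin 2) ℝ} {f₁ f₂ : Plane} {w₁ w₂ d : ℝ}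
    {a₁ a₂ : Plane} {χ : ℕ → Plane → ℝ} {G : ℕ → Plane → Plane} {S : ℕ → Set Plane} {B : ℝ}
    (hχ : ∀ k, IsPhase Ω d (χ k)) (hGm : ∀ k, AEStronglyMeasurable (G k) (volume.restrict Ω))
    (hGB : ∀ k x, ‖G k x‖ ≤ B) (hS : ∀ k, MeasurableSet (S k)) (hSΩ : ∀ k, S k ⊆ Ω)
    (hlim : Tendsto (fun k => volume (S k)) atTop (𝓝 0))
    (hgood : ∀ k, ∀ᵐ x, x ∈ Ω → x ∉ S k → G k x = if χ k x = 1 then a₁ else a₂) :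
    Tendsto (fun k => averageEnergy Ω (phaseEnergy α₁ f₁ w₁) (phaseEnergy α₂ f₂ w₂) (χ k) (G k))
      atTop (𝓝 (d * phaseEnergy α₁ f₁ w₁ a₁ + (1 - d) * phaseEnergy α₂ f₂ w₂ a₂)) := by
  have : IsFiniteMeasure (volume.restrict Ω) := ⟨by simpa using hfin.lt_top⟩
  have hpos : 0 < volume.real Ω := ENNReal.toReal_pos h0 hfin
  obtain ⟨D₁, hD₁⟩ := exists_abs_phaseEnergy_le_of_norm_le α₁ f₁ w₁ B
  obtain ⟨D₂, hD₂⟩ := exists_abs_phaseEnergy_le_of_norm_le α₂ f₂ w₂ B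
  set W₁ := phaseEnergy α₁ f₁ w₁
  set W₂ := phaseEnergy α₂ f₂ w₂
  -- `D` bounds the integrand's deviation on `S k`; off `S k` the deviation is zero almost
  -- everywhere.
  set D := (D₁ + |W₁ a₁|) + (D₂ + |W₂ a₂|)
  have hb : Tendsto (fun k => (volume.real Ω)⁻¹ * (volume.real (S k) * D)) atTop (𝓝 0) := by
    have : Tendsto (fun k => volume.real (S k)) atTop (𝓝 0) :=
      (ENNReal.tendsto_toReal ENNReal.zero_ne_top).comp hlim
    simpa using (this.mul_const D).const_mul (volume.real Ω)⁻¹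
  rw [tendsto_iff_norm_sub_tendsto_zero]
  refine squeeze_zero (fun _ => norm_nonneg _) (fun k => ?_) hb
  have hGp : MemLp (G k) 2 (volume.restrict Ω) :=
    MemLp.of_bound (hGm k) B (Eventually.of_forall (hGB k))
  have hi₁ : IntegrableOn (fun x => W₁ (G k x)) Ω := integrable_phaseEnergy_comp hfin hGp _ _ _
  have hi₂ : IntegrableOn (fun x => W₂ (G k x)) Ω := integrable_phaseEnergy_comp hfin hGp _ _ _
  have hχi : Integrable (χ k) (volume.restrict Ω) := (hχ k).memBV.integrable
  have hE : Integrable (fun x => χ k x * W₁ (G k x) + (1 - χ k x) * W₂ (G k x))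
      (volume.restrict Ω) := by
    have e : (fun x => χ k x * W₁ (G k x) + (1 - χ k x) * W₂ (G k x)) =
        fun x => χ k x * W₁ (G k x) + (W₂ (G k x) - χ k x * W₂ (G k x)) := by ext x; ring
    rw [e]
    exact ((hχ k).integrable_mul hi₁).add (Integrable.sub hi₂ ((hχ k).integrable_mul hi₂))
  have hE0 : Integrable (fun x => χ k x * W₁ a₁ + (1 - χ k x) * W₂ a₂) (volume.restrict Ω) :=
    (hχi.mul_const _).add (((integrable_const 1).sub hχi).mul_const _)
  have e : averageEnergy Ω W₁ W₂ (χ k) (G k) - (d * W₁ a₁ + (1 - d) * W₂ a₂) =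
      (volume.real Ω)⁻¹ * ∫ x in Ω, ((χ k x * W₁ (G k x) + (1 - χ k x) * W₂ (G k x)) -
        (χ k x * W₁ a₁ + (1 - χ k x) * W₂ a₂)) := by
    rw [integral_sub hE hE0, (hχ k).average_mixture hfin h0, averageEnergy, setAverage_eq,
      smul_eq_mul, mul_sub, inv_mul_cancel_left₀ hpos.ne']
  rw [e, norm_mul, Real.norm_of_nonneg (inv_nonneg.2 hpos.le)]
  refine mul_le_mul_of_nonneg_left ?_ (inv_nonneg.2 hpos.le)
  refine (norm_integral_le_of_norm_le (g := (S k).indicator fun _ => D)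
    ((integrable_const D).indicator (hS k)) ?_).trans (le_of_eq ?_)
  · filter_upwards [ae_restrict_of_ae (hgood k), (hχ k).zero_or_one, ae_restrict_mem hΩ]
      with x hx hχx hxΩ
    have b₁ := abs_sub (W₁ (G k x)) (W₁ a₁)
    have b₂ := abs_sub (W₂ (G k x)) (W₂ a₂)
    have c₁ := hD₁ _ (hGB k x)
    have c₂ := hD₂ _ (hGB k x)
    by_cases hxS : x ∈ S k
    · rw [Set.indicator_of_mem hxS, Real.norm_eq_abs]
      have p₁ := abs_nonneg (W₁ (G k x))
      have p₂ := abs_nonneg (W₂ (G k x))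
      have q₁ := abs_nonneg (W₁ a₁)
      have q₂ := abs_nonneg (W₂ a₂)
      rcases hχx with h | h <;> simp only [h] <;> norm_num <;> linarith
    · rw [Set.indicator_of_notMem hxS]
      have hx := hx hxΩ hxS
      rcases hχx with h | h <;> simp [hx, h]
  · rw [integral_indicator (hS k), Measure.restrict_restrict (hS k), Set.inter_eq_left.2 (hSΩ k),
      integral_const]
    simp

lemma exists_rankOneLaminate {Ω : Set Plane} (hΩ : IsOpen Ω) (hbdd : Bornology.IsBounded Ω)
    (hne : Ω.Nonempty) (α₁ α₂ : Matrix (Fin 2) (Fin 2) ℝ) (f₁ f₂ : Plane) (w₁ w₂ : ℝ) {d : ℝ}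
    (hd : d ∈ Set.Icc (0 : ℝ) 1) {f a₁ a₂ n : Plane} (hf : d • a₁ + (1 - d) • a₂ = f)
    (hn : IsLaminationNormal a₁ a₂ n) :
    ∃ (θ : ℕ → ℝ) (η : ℕ → Plane → ℝ) (G : ℕ → Plane → Plane),
      IsRankOneLaminate Ω d f n a₁ a₂ θ η G ∧
      Tendsto (fun k : ℕ => averageEnergy Ω (phaseEnergy α₁ f₁ w₁) (phaseEnergy α₂ f₂ w₂)
        (laminate n (k + 1) (θ k)) (G k)) atTop
        (𝓝 (d * phaseEnergy α₁ f₁ w₁ a₁ + (1 - d) * phaseEnergy α₂ f₂ w₂ a₂)) := by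
  have hfin : volume Ω ≠ ⊤ := hbdd.measure_lt_top.ne
  have h0 : volume Ω ≠ 0 := (hΩ.measure_pos volume hne).ne'
  have hpos : 0 < volume.real Ω := ENNReal.toReal_pos h0 hfin
  obtain ⟨hn1, c, hc⟩ := id hn
  have hN (k : ℕ) : (0 : ℝ) < k + 1 := by positivity
  choose θ hθ hθd using fun k : ℕ => exists_laminate_average hfin hn1 (hN k).ne' hd
  have hθlim : Tendsto θ atTop (𝓝 d) := tendsto_fraction hΩ hbdd hne hn1 hθ hθd
  have hphase (k : ℕ) : IsPhase Ω d (laminate n (k + 1) (θ k)) := by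
    refine ⟨memBV_laminate hbdd (hθ k) n _, Eventually.of_forall (laminate_zero_or_one n _ _), ?_⟩
    rw [setAverage_eq, hθd, smul_eq_mul, inv_mul_cancel_left₀ hpos.ne']
  obtain ⟨R, hR0, hR⟩ := hbdd.exists_pos_norm_le
  -- The sawtooth has gradient `(θ k - χ) n`. The affine term replaces `θ k` by `d`, so that `f +
  -- ∇v` is exactly `a₁` or `a₂`.
  let v : ℕ → Plane → ℝ := fun k x =>
    c * (sawtooth (θ k) ((k + 1) * inner ℝ n x) / (k + 1) + (d - θ k) * inner ℝ n x)
  have hdθ (k : ℕ) : |d - θ k| ≤ 1 := by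
    rw [abs_le]; constructor <;> linarith [hd.1, hd.2, (hθ k).1, (hθ k).2]
  have hvL (k : ℕ) : LipschitzWith (‖c‖₊ * 2) (v k) := by
    have h1 : LipschitzWith 1 (fun x : Plane => (d - θ k) * inner ℝ n x) := by
      refine LipschitzWith.of_dist_le_mul fun x y => ?_
      rw [Real.dist_eq, ← mul_sub, ← inner_sub_right, abs_mul, dist_eq_norm, NNReal.coe_one]
      have := abs_real_inner_le_norm n (x - y)
      rw [hn1, one_mul] at this
      exact mul_le_mul (hdθ k) this (abs_nonneg _) zero_le_one
    have h2 := (lipschitzWith_sawtooth_inner hn1 (hN k) (hθ k)).add h1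
    rw [one_add_one_eq_two] at h2
    exact (lipschitzWith_smul c).comp h2
  let M : ℕ → ℝ := fun k => |c| * (1 / ((k : ℝ) + 1) + |d - θ k| * R)
  have hM0 (k : ℕ) : 0 ≤ M k := by positivity
  have hvM (k : ℕ) (x : Plane) (hx : x ∈ Ω) : |v k x| ≤ M k := by
    simp only [v, M]
    rw [abs_mul]
    refine mul_le_mul_of_nonneg_left ((abs_add_le _ _).trans (add_le_add ?_ ?_)) (abs_nonneg c)
    · rw [abs_div, abs_of_pos (hN k)]
      gcongr
      exact abs_sawtooth_le (hθ k) _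
    · rw [abs_mul]
      refine mul_le_mul_of_nonneg_left ?_ (abs_nonneg _)
      have := abs_real_inner_le_norm n x
      rw [hn1, one_mul] at this
      exact this.trans (hR x hx)
  have hvg (k : ℕ) : ∀ᵐ x, HasGradientAt (v k) ((c * (d - laminate n (k + 1) (θ k) x)) • n) x := by
    filter_upwards [ae_hasGradientAt_sawtooth hn1 (hN k).ne' (θ k)] with x hx
    rw [hasGradientAt_iff_hasFDerivAt] at hx ⊢
    have h1 : HasFDerivAt (fun x : Plane => (d - θ k) * inner ℝ n x)
        ((d - θ k) • innerSL ℝ n) x := ((d - θ k) • innerSL ℝ n : Plane →L[ℝ] ℝ).hasFDerivAt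
    refine ((hx.add h1).const_mul c).congr_fderiv ?_
    ext w
    simp
    ring
  choose u huL huc hus hue using fun k : ℕ =>
    exists_truncation hbdd (hvL k) (Nat.one_div_pos_of_nat (α := ℝ) (n := k)) (hvM k)
  -- Collar width of the truncation: its margin plus the bound `M k` for `v k` on `Ω`. It tends to
  -- `0` because `θ k → d`.
  let r : ℕ → ℝ := fun k => 1 / ((k : ℝ) + 1) + M k
  have hr : Tendsto r atTop (𝓝[>] 0) := by
    refine tendsto_nhdsWithin_iff.2 ⟨?_, Eventually.of_forall fun k => ?_⟩
    · have h1 := tendsto_one_div_add_atTop_nhds_zero_nat (𝕜 := ℝ)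
      have h2 : Tendsto (fun k => |d - θ k|) atTop (𝓝 0) := by
        simpa using (hθlim.const_sub d).abs
      simpa [r, M] using h1.add ((h1.add (h2.mul_const R)).const_mul |c|)
    · exact add_pos_of_pos_of_nonneg (one_div_pos.2 (hN k)) (hM0 k)
  have hcol : Tendsto (fun k => volume (collar Ω (r k))) atTop (𝓝 0) :=
    (tendsto_volume_collar hΩ hbdd).comp hr
  have hgood (k : ℕ) : ∀ᵐ x, x ∈ Ω → x ∉ collar Ω (r k) →
      f + gradient (u k) x = if laminate n (k + 1) (θ k) x = 1 then a₁ else a₂ := by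
    filter_upwards [hvg k] with x hx hxΩ hxc
    rw [(hx.congr_of_eventuallyEq (hue k x hxΩ hxc)).gradient, ← hf, mul_comm, mul_smul, ← hc]
    rcases laminate_zero_or_one n (k + 1) (θ k) x with h | h
    · rw [h, if_neg zero_ne_one]; module
    · rw [h, if_pos rfl]; module
  refine ⟨θ, fun k x => inner ℝ f x + u k x, fun k x => f + gradient (u k) x,
    ⟨hn, hθlim, hphase, fun k => isAdmissible_of_lipschitz hΩ hbdd f (huL k) (huc k) (hus k), ?_⟩,
    ?_⟩
  · refine tendsto_of_tendsto_of_tendsto_of_le_of_le tendsto_const_nhds hcol (fun _ => zero_le)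
      fun k => measure_mono_ae ?_
    filter_upwards [hgood k] with x hx hxb
    by_contra h
    exact hxb.2 (hx hxb.1 h)
  · refine tendsto_averageEnergy hΩ.measurableSet hfin h0 hphase (B := ‖f‖ + (max (‖c‖₊ * 2) 1 : NNReal))
      (fun k => ?_) (fun k x => ?_)
      (fun k => measurableSet_collar hΩ (r k)) (fun k x hx => hx.1) hcol hgood
    · exact (stronglyMeasurable_const.add (stronglyMeasurable_gradient (u k))).aestronglyMeasurable
    · exact (norm_add_le _ _).trans (add_le_add_right (norm_gradient_le (huL k) x) _)

end AntiPlane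

end

/-! ### Matching the two bounds -/

theorem theorem4p2
    (Ω : Set AntiPlane.Plane) (hΩ_open : IsOpen Ω) (hΩ_bdd : Bornology.IsBounded Ω)
    (hΩ_ne : Ω.Nonempty)
    (α₁ α₂ : Matrix (Fin 2) (Fin 2) ℝ) (hα₁ : α₁.PosDef) (hα₂ : α₂.PosDef)
    (f₁ f₂ : AntiPlane.Plane) (w₁ w₂ : ℝ)
    (W₁ W₂ : AntiPlane.Plane → ℝ)
    (hW₁ : W₁ = AntiPlane.phaseEnergy α₁ f₁ w₁) (hW₂ : W₂ = AntiPlane.phaseEnergy α₂ f₂ w₂)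
    (d : ℝ) (hd : d ∈ Set.Icc (0 : ℝ) 1) (f : AntiPlane.Plane)
    (a₁ a₂ : AntiPlane.Plane)
    (ha₁ : a₁ = AntiPlane.optimalStrain₁ α₁ α₂ f₁ f₂ d f)
    (ha₂ : a₂ = AntiPlane.optimalStrain₂ α₁ α₂ f₁ f₂ d f) :
    -- the representation formula
    AntiPlane.relaxedEnergy Ω W₁ W₂ d f = ((d * W₁ a₁ + (1 - d) * W₂ a₂ : ℝ) : EReal) ∧
    -- the strains have mean `f` and there is no jump of the stress
    d • a₁ + (1 - d) • a₂ = f ∧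
    AntiPlane.act α₁ (a₁ - f₁) = AntiPlane.act α₂ (a₂ - f₂) ∧
    -- the translation is trivial: the optimal parameter is `0`, and gives the exact bound
    0 ∈ AntiPlane.translationParameters W₁ W₂ ∧
    IsMaxOn (AntiPlane.translationBound W₁ W₂ d f) (AntiPlane.translationParameters W₁ W₂) 0 ∧
    AntiPlane.translationBound W₁ W₂ d f 0 = AntiPlane.relaxedEnergy Ω W₁ W₂ d f ∧
    -- a rank-one laminate with strains `a₁`, `a₂` is optimal; its normal is unique up to sign
    (∃ n, AntiPlane.IsLaminationNormal a₁ a₂ n) ∧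
    (a₁ ≠ a₂ → ∀ m n, AntiPlane.IsLaminationNormal a₁ a₂ m →
      AntiPlane.IsLaminationNormal a₁ a₂ n → m = n ∨ m = -n) ∧
    (∀ n, AntiPlane.IsLaminationNormal a₁ a₂ n →
      ∃ (θ : ℕ → ℝ) (η : ℕ → AntiPlane.Plane → ℝ)
        (G : ℕ → AntiPlane.Plane → AntiPlane.Plane),
        AntiPlane.IsRankOneLaminate Ω d f n a₁ a₂ θ η G ∧
        Filter.Tendsto (fun k : ℕ => ((AntiPlane.averageEnergy Ω W₁ W₂
            (AntiPlane.laminate n (k + 1) (θ k)) (G k) : ℝ) : EReal))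
          Filter.atTop (nhds (AntiPlane.relaxedEnergy Ω W₁ W₂ d f))) := by
  subst hW₁ hW₂
  have hfin : volume Ω ≠ ⊤ := hΩ_bdd.measure_lt_top.ne
  have h0 : volume Ω ≠ 0 := (hΩ_open.measure_pos volume hΩ_ne).ne'
  have hf : d • a₁ + (1 - d) • a₂ = f := by
    rw [ha₁, ha₂]; exact AntiPlane.optimalStrain_average hα₁ hα₂ hd f₁ f₂ f
  have hσ : AntiPlane.act α₁ (a₁ - f₁) = AntiPlane.act α₂ (a₂ - f₂) := by
    rw [ha₁, ha₂]; exact AntiPlane.optimalStrain_stress hα₁ hα₂ hd f₁ f₂ f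
  have ht₁ := AntiPlane.phaseEnergy_tangent hα₁ f₁ w₁ a₁
  have ht₂ := AntiPlane.phaseEnergy_tangent hα₂ f₂ w₂ a₂
  -- Both tangent planes now have the same slope, the common stress.
  rw [← hσ] at ht₂
  have hlam (n : AntiPlane.Plane) (hn : AntiPlane.IsLaminationNormal a₁ a₂ n) :=
    AntiPlane.exists_rankOneLaminate hΩ_open hΩ_bdd hΩ_ne α₁ α₂ f₁ f₂ w₁ w₂ hd hf hn
  have hW : AntiPlane.relaxedEnergy Ω (AntiPlane.phaseEnergy α₁ f₁ w₁) (AntiPlane.phaseEnergy α₂ f₂ w₂) d f =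
      ((d * AntiPlane.phaseEnergy α₁ f₁ w₁ a₁ + (1 - d) * AntiPlane.phaseEnergy α₂ f₂ w₂ a₂ : ℝ) : EReal) := by
    refine le_antisymm ?_ ?_
    · obtain ⟨n, hn⟩ := AntiPlane.exists_isLaminationNormal a₁ a₂
      obtain ⟨θ, η, G, hG, hlim⟩ := hlam n hn
      -- Every laminate is a competitor, so the infimum lies below each energy and hence below their
      -- limit.
      refine ge_of_tendsto (continuous_coe_real_ereal.continuousAt.tendsto.comp hlim)
        (Eventually.of_forall fun k => ?_)
      exact (iInf₂_le _ (hG.phase k)).trans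
        ((iInf_le _ (η k)).trans (iInf₂_le (G k) (hG.admissible k)))
    · simp only [AntiPlane.relaxedEnergy, le_iInf_iff]
      intro χ hχ η G hη
      exact EReal.coe_le_coe_iff.2 (AntiPlane.le_averageEnergy hfin h0 hχ hη hf ht₁ ht₂
        (AntiPlane.integrable_phaseEnergy_comp hfin hη.h1.memLp_grad _ _ _)
        (AntiPlane.integrable_phaseEnergy_comp hfin hη.h1.memLp_grad _ _ _))
  refine ⟨hW, hf, hσ, ⟨le_rfl, ?_, ?_⟩, AntiPlane.isMaxOn_translationBound hd f _ _, ?_,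
    AntiPlane.exists_isLaminationNormal a₁ a₂, fun h m n hm hn => hm.eq_or_eq_neg h hn, fun n hn => ?_⟩
  · simpa using AntiPlane.convexOn_phaseEnergy hα₁ f₁ w₁
  · simpa using AntiPlane.convexOn_phaseEnergy hα₂ f₂ w₂
  · rw [hW]; exact AntiPlane.translationBound_zero hd hf ht₁ ht₂
  · obtain ⟨θ, η, G, hG, hlim⟩ := hlam n hn
    refine ⟨θ, η, G, hG, ?_⟩
    rw [hW]
    exact continuous_coe_real_ereal.continuousAt.tendsto.comp hlim
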